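/- Let $P$ be a finite set of points on a line (a totally ordered set of coordinates, distinct points having distinct coordinates), each point having a color from a totally ordered set of colors, and let $\tau\in(0,1]$ be a fixed parameter. A color $c$ dominates an interval $Q=[a,b]$ if $P\cap Q\ne\emptyset$ and $|\{p\in P\cap Q : \mathrm{col}(p)=c\}|\ge \tau\,|P\cap Q|$. A one-dimensional domination query asks for all colors that dominate a given interval $[a,b]$, each reported once. The model of computation is a pointer machine with unit cost per step, with words of $\log_2(n_{\max}+1/\tau)+O(1)$ bits or more, where $n_{\max}$ is the largest number of points ever present; coordinates and colors can be copied and compared with each other in one step, and it can be tested in one step whether $x\ge\tau y$ for two integers $x,y$. The structure starts with $P=\emptyset$, and $n=|P|$ denotes the current number of points. All constants are absolute, in particular independent of $\tau$; the bounds are read with $\log(n+2)$ for $\log n$ and up to an additive $O(1)$ in the space. (1) There exists a data structure of space $O(n/\tau)$ that supports one-dimensional domination queries and insertions in $O(\frac1\tau\log^2 n)$ worst-case time and deletions in $O(\frac1\tau\log^2 n)$ amortized time. (2) There exists a data structure of space $O(\frac1\tau n\log n)$ that supports one-dimensional domination queries and insertions in $O(\frac1\tau\log n)$ worst-case time and deletions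 in $O(\frac1\tau\log n)$ amortized time. Here the amortized bound means that in every sequence of operations the total time of the deletions is at most the sum of their bounds. -/

import Mathlib

/-! A step-counting machine, and dynamic data structures for one-dimensional domination queries
running on it. -/

universe u v

namespace Domination

/-- What a machine word can denote: the null pointer, an integer, a point coordinate, a color, or a
pointer to a memory cell with two fields. Cells are never overwritten, so a pointer is identified
with the tree of cells below it. -/
inductive Val (α : Type u) (κ : Type v) where
  | nil : Val α κ
  | num (n : ℕ) : Val α κ
  | key (x : α) : Val α κ
  | col (c : κ) : Val α κ
  | pair (a b : Val α κ) : Val α κ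

namespace Val

variable {α : Type u} {κ : Type v}

/-- The number of words that a value occupies (shared cells are counted once per occurrence, so
that this is an upper bound for the memory in use). -/
def size : Val α κ → ℕ
  | pair a b => a.size + b.size + 1
  | _ => 1

/-- The outcome of a test. -/
def ofTest (p : Prop) [Decidable p] : Val α κ := if p then num 1 else num 0

/-- The linked list of the given colors. -/
def ofColors : List κ → Val α κ
  | [] => nil
  | c :: l => pair (col c) (ofColors l)

end Val

/-- Program text: the code of a procedure. Variables are numbered from the innermost binding. -/
inductive Term where
  /-- the value of a local variable -/
  | var (i : ℕ)
  /-- the null pointer -/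
  | nil
  /-- an integer constant -/
  | num (n : ℕ)
  /-- allocate a cell -/
  | pair (a b : Term)
  /-- if `e` is the null pointer run `z`; if it points to a cell, load both fields and run `s` -/
  | casePair (e z s : Term)
  /-- integer addition -/
  | add (a b : Term)
  /-- integer subtraction, truncated at zero -/
  | sub (a b : Term)
  /-- compare two integers, two coordinates, or two colors -/
  | le (a b : Term)
  /-- for integers `a` and `b`, test whether `a ≥ τ * b` -/
  | frac (a b : Term)
  /-- bind the value of `a` to a new local variable and run `b` -/
  | bind (a b : Term)
  /-- branch on the outcome of a test -/
  | ite (c t e : Term)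
  /-- call procedure number `f` with the value of `a` as its only local variable -/
  | call (f : ℕ) (a : Term)

/-- `Eval prog w τ env e r t`: with the procedures `prog`, words of `w` bits, domination parameter
`τ` and local variables `env`, the code `e` terminates with result `r` after exactly `t` steps.
Coordinates and colors can only be copied and compared. An integer that does not fit into a word
makes the machine fail. -/
inductive Eval {α : Type u} {κ : Type v} [LinearOrder α] [LinearOrder κ]
    (prog : List Term) (w : ℕ) (τ : ℝ) : List (Val α κ) → Term → Val α κ → ℕ → Prop where
  | var {env : List (Val α κ)} {i : ℕ} {r : Val α κ} (h : env[i]? = some r) :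
      Eval prog w τ env (.var i) r 1
  | nil {env : List (Val α κ)} : Eval prog w τ env .nil .nil 1
  | num {env : List (Val α κ)} {n : ℕ} (h : n < 2 ^ w) : Eval prog w τ env (.num n) (.num n) 1
  | pair {env : List (Val α κ)} {a b : Term} {x y : Val α κ} {s t : ℕ}
      (ha : Eval prog w τ env a x s) (hb : Eval prog w τ env b y t) :
      Eval prog w τ env (.pair a b) (.pair x y) (s + t + 1)
  | caseNil {env : List (Val α κ)} {e z c : Term} {r : Val α κ} {s t : ℕ}
      (he : Eval prog w τ env e .nil s) (hz : Eval prog w τ env z r t) :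
      Eval prog w τ env (.casePair e z c) r (s + t + 1)
  | casePair {env : List (Val α κ)} {e z c : Term} {x y r : Val α κ} {s t : ℕ}
      (he : Eval prog w τ env e (.pair x y) s) (hc : Eval prog w τ (x :: y :: env) c r t) :
      Eval prog w τ env (.casePair e z c) r (s + t + 1)
  | add {env : List (Val α κ)} {a b : Term} {m n s t : ℕ}
      (ha : Eval prog w τ env a (.num m) s) (hb : Eval prog w τ env b (.num n) t)
      (h : m + n < 2 ^ w) :
      Eval prog w τ env (.add a b) (.num (m + n)) (s + t + 1)
  | sub {env : List (Val α κ)} {a b : Term} {m n s t : ℕ}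
      (ha : Eval prog w τ env a (.num m) s) (hb : Eval prog w τ env b (.num n) t) :
      Eval prog w τ env (.sub a b) (.num (m - n)) (s + t + 1)
  | leNum {env : List (Val α κ)} {a b : Term} {m n s t : ℕ}
      (ha : Eval prog w τ env a (.num m) s) (hb : Eval prog w τ env b (.num n) t) :
      Eval prog w τ env (.le a b) (.ofTest (m ≤ n)) (s + t + 1)
  | leKey {env : List (Val α κ)} {a b : Term} {x y : α} {s t : ℕ}
      (ha : Eval prog w τ env a (.key x) s) (hb : Eval prog w τ env b (.key y) t) :
      Eval prog w τ env (.le a b) (.ofTest (x ≤ y)) (s + t + 1)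
  | leCol {env : List (Val α κ)} {a b : Term} {x y : κ} {s t : ℕ}
      (ha : Eval prog w τ env a (.col x) s) (hb : Eval prog w τ env b (.col y) t) :
      Eval prog w τ env (.le a b) (.ofTest (x ≤ y)) (s + t + 1)
  | frac {env : List (Val α κ)} {a b : Term} {m n s t : ℕ}
      (ha : Eval prog w τ env a (.num m) s) (hb : Eval prog w τ env b (.num n) t) :
      Eval prog w τ env (.frac a b) (.ofTest (τ * (n : ℝ) ≤ (m : ℝ))) (s + t + 1)
  | bind {env : List (Val α κ)} {a b : Term} {x r : Val α κ} {s t : ℕ}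
      (ha : Eval prog w τ env a x s) (hb : Eval prog w τ (x :: env) b r t) :
      Eval prog w τ env (.bind a b) r (s + t + 1)
  | iteTrue {env : List (Val α κ)} {c a b : Term} {r : Val α κ} {s t : ℕ}
      (hc : Eval prog w τ env c (.num 1) s) (ha : Eval prog w τ env a r t) :
      Eval prog w τ env (.ite c a b) r (s + t + 1)
  | iteFalse {env : List (Val α κ)} {c a b : Term} {r : Val α κ} {s t : ℕ}
      (hc : Eval prog w τ env c (.num 0) s) (hb : Eval prog w τ env b r t) :
      Eval prog w τ env (.ite c a b) r (s + t + 1)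
  | call {env : List (Val α κ)} {f : ℕ} {a body : Term} {x r : Val α κ} {s t : ℕ}
      (ha : Eval prog w τ env a x s) (hf : prog[f]? = some body)
      (hb : Eval prog w τ [x] body r t) :
      Eval prog w τ env (.call f a) r (s + t + 1)

section Queries

variable {α : Type u} {κ : Type v} [LinearOrder α] [LinearOrder κ]

/-- The points of `S` in `[a, b]`. A colored point is a pair (coordinate, color). -/
def inRange (S : Finset (α × κ)) (a b : α) : Finset (α × κ) :=
  S.filter fun p => a ≤ p.1 ∧ p.1 ≤ b

/-- The color `c` `τ`-dominates `[a, b]`: there are points in `[a, b]`, and at least a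
`τ`-fraction of them has color `c`. -/
def Dominates (τ : ℝ) (S : Finset (α × κ)) (a b : α) (c : κ) : Prop :=
  (inRange S a b).Nonempty ∧
    τ * ((inRange S a b).card : ℝ) ≤ (((inRange S a b).filter fun p => p.2 = c).card : ℝ)

end Queries

/-- The code of a dynamic data structure: a list of procedures, and the code of the four
operations. -/
structure DynStructure where
  /-- the procedures -/
  prog : List Term
  /-- no local variable; returns the structure for the empty set -/
  empty : Term
  /-- local variables: structure, coordinate, color; returns the new structure -/
  insert : Term
  /-- local variables: structure, coordinate; returns the new structure -/
  delete : Term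
  /-- local variables: structure, left end, right end; returns the list of reported colors -/
  query : Term

namespace DynStructure

variable {α : Type u} {κ : Type v} [LinearOrder α] [LinearOrder κ]

/-- `D.Reach w τ N S s L`: starting from the empty structure, some sequence of insertions (of
points with new coordinates) and deletions (of points in the set), during which the set never has
more than `N` points, makes `S` the current point set and `s` the current structure. The list `L`
has, for every deletion so far, the number of points before it and its number of steps. -/
inductive Reach (D : DynStructure) (w : ℕ) (τ : ℝ) (N : ℕ) :
    Finset (α × κ) → Val α κ → List (ℕ × ℕ) → Prop where
  | empty {s : Val α κ} {t : ℕ} (h : Eval D.prog w τ [] D.empty s t) :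
      Reach D w τ N ∅ s []
  | insert {S : Finset (α × κ)} {s s' : Val α κ} {L : List (ℕ × ℕ)} {t : ℕ} (x : α) (c : κ)
      (h : Reach D w τ N S s L) (hx : ∀ p ∈ S, p.1 ≠ x) (hN : S.card < N)
      (he : Eval D.prog w τ [s, .key x, .col c] D.insert s' t) :
      Reach D w τ N (Insert.insert (x, c) S) s' L
  | delete {S : Finset (α × κ)} {s s' : Val α κ} {L : List (ℕ × ℕ)} {t : ℕ} (x : α) (c : κ)
      (h : Reach D w τ N S s L) (hx : (x, c) ∈ S)
      (he : Eval D.prog w τ [s, .key x] D.delete s' t) :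
      Reach D w τ N (S.erase (x, c)) s' ((S.card, t) :: L)

/-- `D` is a correct dynamic data structure for one-dimensional domination queries, on every
ordered set `α` of coordinates, every ordered set `κ` of colors and for every parameter `τ`, as
long as words can hold `K * (N + 1 / τ)`, where `N` is the largest number of points that are ever
present. With `n` the number of points currently present, it occupies at most `space τ n` words,
answers a query in `time τ n` steps, performs an insertion in `time τ n` steps, and deletions take
`time τ n` amortized steps: in every history, the total number of steps of all deletions is at
most the sum of their bounds. -/
def Supports (D : DynStructure) (K : ℝ) (space time : ℝ → ℕ → ℝ) : Prop :=
  ∀ (α : Type u) (κ : Type v) [LinearOrder α] [LinearOrder κ] (τ : ℝ) (w N : ℕ),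
    0 < τ → τ ≤ 1 → K * ((N : ℝ) + 1 / τ) ≤ 2 ^ w →
    (∃ (s : Val α κ) (t : ℕ), Eval D.prog w τ [] D.empty s t ∧ (t : ℝ) ≤ K) ∧
    ∀ (S : Finset (α × κ)) (s : Val α κ) (L : List (ℕ × ℕ)), D.Reach w τ N S s L →
      -- space
      (s.size : ℝ) ≤ space τ S.card ∧
      -- queries: the reported colors are the dominating ones, each reported once
      (∀ a b : α, ∃ (out : List κ) (t : ℕ),
        Eval D.prog w τ [s, .key a, .key b] D.query (.ofColors out) t ∧
        out.Nodup ∧ (∀ c, c ∈ out ↔ Dominates τ S a b c) ∧ (t : ℝ) ≤ time τ S.card) ∧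
      -- insertions
      (∀ (x : α) (c : κ), (∀ p ∈ S, p.1 ≠ x) → S.card < N → ∃ (s' : Val α κ) (t : ℕ),
        Eval D.prog w τ [s, .key x, .col c] D.insert s' t ∧ (t : ℝ) ≤ time τ S.card) ∧
      -- deletions terminate
      (∀ (x : α) (c : κ), (x, c) ∈ S → ∃ (s' : Val α κ) (t : ℕ),
        Eval D.prog w τ [s, .key x] D.delete s' t) ∧
      -- amortized bound for the deletions
      ((L.map fun d => (d.2 : ℝ)).sum ≤ (L.map fun d => time τ d.1).sum)

end DynStructure

end Domination

/-! A single structure proves both claims. It uses O(n/τ) words and O(log n / τ) worst-case steps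
for each query and each update, deletions included. Claim (1) then gives away a logarithm in the
time, claim (2) a logarithm in the space.

Put m = ⌊1/τ⌋. A color that dominates an interval with L > 0 points occurs at least τL > L/(m+1)
times in it. Misra-Gries summaries with at most m counters retain all such colors: they satisfy
(m+1)(count - counter) ≤ L - total for every color, so a color without a counter occurs at most
L/(m+1) times (`Summary.Describes.mem_of_lt`). To merge two summaries, add their counters. If more
than m are left, subtract the (m+1)-st largest counter x from all of them and drop those that
vanish. Each counter loses at most x, while the total loses at least (m+1)x, so the inequality
survives (`Summary.Describes.join`). Selection in linear time (`calls_select`) makes a merge cost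
O(m).

The points are stored in two weight-balanced leaf-oriented trees, ordered by (coordinate, color) and
by (color, coordinate), with a summary at each inner node. The first tree yields a summary of [a, b]
from O(log n) merges, hence at most m candidates. The second gives the exact frequency of each
candidate as a difference of two ranks (`Represents.countLE_sub_countLT`). An update rebuilds the
summaries along one search path of each tree.

For the machine, the only repetition in the code is by procedure calls. Hence one activation takes a
bounded number of steps of its own, and it suffices to count activations (`Runs`, `Calls`). Each
procedure is matched with a function on lists, summaries or trees whose correctness is a purely
mathematical statement. Determinism (`Eval.det`) carries the computed runs over to arbitrary
histories. -/

namespace Domination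

/-! ### Size of program text, and abbreviations for tuples -/

namespace Term

/-- The number of nodes of the program text, which bounds the steps of one activation. -/
def nodes : Term → ℕ
  | var _ => 1
  | nil => 1
  | num _ => 1
  | pair a b => a.nodes + b.nodes + 1
  | casePair e z s => e.nodes + z.nodes + s.nodes + 1
  | add a b => a.nodes + b.nodes + 1
  | sub a b => a.nodes + b.nodes + 1
  | le a b => a.nodes + b.nodes + 1
  | frac a b => a.nodes + b.nodes + 1
  | bind a b => a.nodes + b.nodes + 1
  | ite c t e => c.nodes + t.nodes + e.nodes + 1
  | call _ a => a.nodes + 1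

/-- Load the two components of the argument; they become variables 0 and 1. -/
def args2 (b : Term) : Term := .casePair (.var 0) .nil b

/-- Load the three components of the argument; they become variables 2, 0 and 1. -/
def args3 (b : Term) : Term := args2 (.casePair (.var 1) .nil b)

/-- Load the four components of the argument; they become variables 4, 2, 0 and 1. -/
def args4 (b : Term) : Term := args3 (.casePair (.var 1) .nil b)

def tuple3 (a b c : Term) : Term := .pair a (.pair b c)

def tuple4 (a b c d : Term) : Term := .pair a (.pair b (.pair c d))

end Term

/-! ### Procedure numbers -/

namespace Proc

abbrev merge : ℕ := 0
abbrev counts : ℕ := 1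
abbrev length : ℕ := 2
abbrev half : ℕ := 3
abbrev median : ℕ := 4
abbrev thirds : ℕ := 5
abbrev above : ℕ := 6
abbrev below : ℕ := 7
abbrev select : ℕ := 8
abbrev reduce : ℕ := 9
abbrev join : ℕ := 10
abbrev sum : ℕ := 11
abbrev size : ℕ := 12
abbrev node : ℕ := 13
abbrev rotL : ℕ := 14
abbrev rotR : ℕ := 15
abbrev balance : ℕ := 16
abbrev lex : ℕ := 17
abbrev insert : ℕ := 18
abbrev delete : ℕ := 19
abbrev from' : ℕ := 20
abbrev upto : ℕ := 21
abbrev range : ℕ := 22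
abbrev countLE : ℕ := 23
abbrev countLT : ℕ := 24
abbrev verify : ℕ := 25
abbrev limit : ℕ := 26

end Proc

/-! ### Program text -/

namespace Body

open Term

/-- Argument: two sorted association lists. -/
def merge : Term := args2 <|
  .casePair (.var 0) (.var 1) <| .casePair (.var 3) (.var 2) <|
  .casePair (.var 2) .nil <| .casePair (.var 2) .nil <|
  .ite (.le (.var 2) (.var 0))
    (.ite (.le (.var 0) (.var 2))
      (.pair (.pair (.var 2) (.add (.var 3) (.var 1)))
        (.call Proc.merge (.pair (.var 7) (.var 5))))
      (.pair (.var 6) (.call Proc.merge (.pair (.var 7) (.var 9)))))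
    (.pair (.var 4) (.call Proc.merge (.pair (.var 8) (.var 5))))

/-- Argument: an association list. -/
def counts : Term :=
  .casePair (.var 0) .nil
    (.pair (.casePair (.var 0) .nil (.var 1)) (.call Proc.counts (.var 1)))

def length : Term :=
  .casePair (.var 0) (.num 0) (.add (.num 1) (.call Proc.length (.var 1)))

def half : Term :=
  .casePair (.var 0) (.num 0) <| .casePair (.var 1) (.num 0) <|
  .add (.num 1) (.call Proc.half (.var 1))

/-- Argument: three numbers. -/
def median : Term := args3 <|
  .ite (.le (.var 2) (.var 0))
    (.ite (.le (.var 0) (.var 1)) (.var 0) (.ite (.le (.var 2) (.var 1)) (.var 1) (.var 2)))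
    (.ite (.le (.var 2) (.var 1)) (.var 2) (.ite (.le (.var 0) (.var 1)) (.var 1) (.var 0)))

def thirds : Term :=
  .casePair (.var 0) .nil <| .casePair (.var 1) .nil <| .casePair (.var 1) .nil <|
  .pair (.call Proc.median (tuple3 (.var 4) (.var 2) (.var 0))) (.call Proc.thirds (.var 1))

/-- Argument: a pivot and a list of numbers. -/
def above : Term := args2 <|
  .casePair (.var 1) .nil <|
  .ite (.le (.var 0) (.var 2)) (.call Proc.above (.pair (.var 2) (.var 1)))
    (.pair (.var 0) (.call Proc.above (.pair (.var 2) (.var 1))))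

/-- Argument: a pivot and a list of numbers. -/
def below : Term := args2 <|
  .casePair (.var 1) .nil <|
  .ite (.le (.var 2) (.var 0)) (.call Proc.below (.pair (.var 2) (.var 1)))
    (.pair (.var 0) (.call Proc.below (.pair (.var 2) (.var 1))))

/-- Argument: a list of numbers and a rank. -/
def select : Term := args2 <|
  .bind (.call Proc.thirds (.call Proc.thirds (.var 0))) <|
  -- With fewer than nine numbers there are no nested medians and the head of the list is the pivot.
  -- The 0 is a dummy for the empty list, which has no valid rank.
  .bind (.casePair (.var 0) (.casePair (.var 1) (.num 0) (.var 0))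
    (.call Proc.select (.pair (.var 2) (.call Proc.half (.var 2))))) <|
  .bind (.call Proc.above (.pair (.var 0) (.var 2))) <|
  .bind (.call Proc.below (.pair (.var 1) (.var 3))) <|
  .bind (.call Proc.length (.var 1)) <|
  .bind (.sub (.call Proc.length (.var 5)) (.call Proc.length (.var 1))) <|
  -- Variable 0 counts the numbers that are at least the pivot, variable 1 those above it, and
  -- variable 7 is the rank. The pivot is the answer if variable 1 ≤ rank < variable 0.
  .ite (.le (.var 1) (.var 7))
    (.ite (.le (.var 0) (.var 7))
      (.call Proc.select (.pair (.var 2) (.sub (.var 7) (.var 0)))) (.var 4))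
    (.call Proc.select (.pair (.var 3) (.var 7)))

/-- Argument: a number and an association list. -/
def reduce : Term := args2 <|
  .casePair (.var 1) .nil <| .casePair (.var 0) .nil <|
  .ite (.le (.var 1) (.var 4)) (.call Proc.reduce (.pair (.var 4) (.var 3)))
    (.pair (.pair (.var 0) (.sub (.var 1) (.var 4))) (.call Proc.reduce (.pair (.var 4) (.var 3))))

/-- Argument: the limit and two summaries. -/
def join : Term := args3 <|
  .casePair (.var 0) .nil <| .casePair (.var 3) .nil <|
  .pair (.add (.var 2) (.var 0)) <|
  .bind (.call Proc.merge (.pair (.var 3) (.var 1))) <|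
  .bind (.call Proc.counts (.var 0)) <|
  .ite (.le (.call Proc.length (.var 0)) (.var 8)) (.var 1)
    (.call Proc.reduce (.pair (.call Proc.select (.pair (.var 0) (.var 8))) (.var 1)))

/-- Argument: a tree. -/
def sum : Term :=
  .casePair (.var 0) (.pair (.num 0) .nil) <|
  .casePair (.var 0)
    (.casePair (.var 1) .nil (.pair (.num 1) (.pair (.pair (.var 1) (.num 1)) .nil)))
    (.var 0)

/-- Argument: a tree. -/
def size : Term := .casePair (.call Proc.sum (.var 0)) .nil (.var 0)

/-- Argument: the limit, the left subtree, the key, the right subtree. -/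
def node : Term := args4 <|
  .pair
    (.pair (.call Proc.join
      (tuple3 (.var 4) (.call Proc.sum (.var 2)) (.call Proc.sum (.var 1)))) (.var 0))
    (.pair (.var 2) (.var 1))

/-- Argument as for `node`. -/
def rotL : Term := args4 <|
  .casePair (.var 1) .nil <| .casePair (.var 0) .nil <| .casePair (.var 3) .nil <|
  .ite (.le (.add (.call Proc.size (.var 1)) (.call Proc.size (.var 1)))
      (.call Proc.size (.var 0)))
    (.casePair (.var 0) .nil <| .casePair (.var 0) .nil <| .casePair (.var 3) .nil <|
      .call Proc.node (tuple4 (.var 16)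
        (.call Proc.node (tuple4 (.var 16) (.var 14) (.var 12) (.var 0))) (.var 3)
        (.call Proc.node (tuple4 (.var 16) (.var 1) (.var 9) (.var 7)))))
    (.call Proc.node (tuple4 (.var 10)
      (.call Proc.node (tuple4 (.var 10) (.var 8) (.var 6) (.var 0))) (.var 3) (.var 1)))

/-- Argument as for `node`. -/
def rotR : Term := args4 <|
  .casePair (.var 2) .nil <| .casePair (.var 0) .nil <| .casePair (.var 3) .nil <|
  .ite (.le (.add (.call Proc.size (.var 0)) (.call Proc.size (.var 0)))
      (.call Proc.size (.var 1)))
    (.casePair (.var 1) .nil <| .casePair (.var 0) .nil <| .casePair (.var 3) .nil <|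
      .call Proc.node (tuple4 (.var 16)
        (.call Proc.node (tuple4 (.var 16) (.var 6) (.var 9) (.var 0))) (.var 3)
        (.call Proc.node (tuple4 (.var 16) (.var 1) (.var 12) (.var 13)))))
    (.call Proc.node (tuple4 (.var 10) (.var 0) (.var 3)
      (.call Proc.node (tuple4 (.var 10) (.var 1) (.var 6) (.var 7)))))

/-- Argument as for `node`. -/
def balance : Term := args4 <|
  .casePair (.var 2) (.var 1) <| .casePair (.var 3) (.var 4) <|
  .bind (.call Proc.size (.var 6)) <| .bind (.call Proc.size (.var 6)) <|
  .ite (.le (.var 0) (.add (.var 1) (.add (.var 1) (.var 1))))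
    (.ite (.le (.var 1) (.add (.var 0) (.add (.var 0) (.var 0))))
      (.call Proc.node (.var 12)) (.call Proc.rotR (.var 12)))
    (.call Proc.rotL (.var 12))

/-- Argument: two entries. -/
def lex : Term := args2 <|
  .casePair (.var 0) .nil <| .casePair (.var 3) .nil <|
  .ite (.le (.var 2) (.var 0))
    (.ite (.le (.var 0) (.var 2)) (.le (.var 3) (.var 1)) (.num 1)) (.num 0)

/-- Argument: the limit, an entry and a tree. -/
def insert : Term := args3 <|
  .casePair (.var 1) (.pair .nil (.var 0)) <|
  .casePair (.var 0)
    (.ite (.call Proc.lex (.pair (.var 2) (.var 1)))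
      (.call Proc.node (tuple4 (.var 4) (.pair .nil (.var 2)) (.var 2) (.var 3)))
      (.call Proc.node (tuple4 (.var 4) (.var 3) (.var 1) (.pair .nil (.var 2))))) <|
  .casePair (.var 3) .nil <|
  .ite (.call Proc.lex (.pair (.var 6) (.var 3)))
    (.call Proc.balance (tuple4 (.var 8)
      (.call Proc.insert (tuple3 (.var 8) (.var 6) (.var 0))) (.var 3) (.var 1)))
    (.call Proc.balance (tuple4 (.var 8) (.var 0) (.var 3)
      (.call Proc.insert (tuple3 (.var 8) (.var 6) (.var 1)))))

/-- Argument: the limit, an entry and a tree. -/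
def delete : Term := args3 <|
  .casePair (.var 1) .nil <| .casePair (.var 0) .nil <| .casePair (.var 3) .nil <|
  .ite (.call Proc.lex (.pair (.var 6) (.var 3)))
    (.call Proc.balance (tuple4 (.var 8)
      (.call Proc.delete (tuple3 (.var 8) (.var 6) (.var 0))) (.var 3) (.var 1)))
    (.call Proc.balance (tuple4 (.var 8) (.var 0) (.var 3)
      (.call Proc.delete (tuple3 (.var 8) (.var 6) (.var 1)))))

/-- Argument: the limit, a left end and a tree. -/
def from' : Term := args3 <|
  .casePair (.var 1) (.pair (.num 0) .nil) <|
  .casePair (.var 0)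
    (.casePair (.var 1) .nil
      (.ite (.le (.var 4) (.var 0)) (.call Proc.sum (.var 5)) (.pair (.num 0) .nil))) <|
  .casePair (.var 3) .nil <|
  .ite (.le (.var 6) (.casePair (.var 3) .nil (.var 0)))
    (.call Proc.join (tuple3 (.var 8)
      (.call Proc.from' (tuple3 (.var 8) (.var 6) (.var 0))) (.call Proc.sum (.var 1))))
    (.call Proc.from' (tuple3 (.var 8) (.var 6) (.var 1)))

/-- Argument: the limit, a right end and a tree. -/
def upto : Term := args3 <|
  .casePair (.var 1) (.pair (.num 0) .nil) <|
  .casePair (.var 0)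
    (.casePair (.var 1) .nil
      (.ite (.le (.var 0) (.var 4)) (.call Proc.sum (.var 5)) (.pair (.num 0) .nil))) <|
  .casePair (.var 3) .nil <|
  .ite (.le (.casePair (.var 3) .nil (.var 0)) (.var 6))
    (.call Proc.join (tuple3 (.var 8) (.call Proc.sum (.var 0))
      (.call Proc.upto (tuple3 (.var 8) (.var 6) (.var 1)))))
    (.call Proc.upto (tuple3 (.var 8) (.var 6) (.var 0)))

/-- Argument: the limit, both ends and a tree. -/
def range : Term := args4 <|
  .casePair (.var 1) (.pair (.num 0) .nil) <|
  .casePair (.var 0)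
    (.casePair (.var 1) .nil
      (.ite (.le (.var 6) (.var 0))
        (.ite (.le (.var 0) (.var 4)) (.call Proc.sum (.var 5)) (.pair (.num 0) .nil))
        (.pair (.num 0) .nil))) <|
  .casePair (.var 3) .nil <|
  .ite (.le (.var 8) (.casePair (.var 3) .nil (.var 0)))
    (.ite (.le (.casePair (.var 3) .nil (.var 0)) (.var 6))
      (.call Proc.join (tuple3 (.var 10)
        (.call Proc.from' (tuple3 (.var 10) (.var 8) (.var 0)))
        (.call Proc.upto (tuple3 (.var 10) (.var 6) (.var 1)))))
      (.call Proc.range (tuple4 (.var 10) (.var 8) (.var 6) (.var 0))))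
    (.call Proc.range (tuple4 (.var 10) (.var 8) (.var 6) (.var 1)))

/-- Argument: an entry and a tree. -/
def countLE : Term := args2 <|
  .casePair (.var 1) (.num 0) <|
  .casePair (.var 0)
    (.ite (.call Proc.lex (.pair (.var 1) (.var 2))) (.num 1) (.num 0)) <|
  .casePair (.var 3) .nil <|
  .ite (.call Proc.lex (.pair (.var 3) (.var 6)))
    (.add (.call Proc.size (.var 0)) (.call Proc.countLE (.pair (.var 6) (.var 1))))
    (.call Proc.countLE (.pair (.var 6) (.var 0)))

/-- Argument: an entry and a tree. -/
def countLT : Term := args2 <|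
  .casePair (.var 1) (.num 0) <|
  .casePair (.var 0)
    (.ite (.call Proc.lex (.pair (.var 2) (.var 1))) (.num 0) (.num 1)) <|
  .casePair (.var 3) .nil <|
  .ite (.call Proc.lex (.pair (.var 6) (.var 3)))
    (.call Proc.countLT (.pair (.var 6) (.var 0)))
    (.add (.call Proc.size (.var 0)) (.call Proc.countLT (.pair (.var 6) (.var 1))))

/-- Argument: a tuple (number of points, left end, right end, tree) and a list of candidates. -/
def verify : Term := args2 <|
  .casePair (.var 1) .nil <| .casePair (.var 0) .nil <|
  .bind (.call Proc.verify (.pair (.var 4) (.var 3))) <|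
  .casePair (.var 5) .nil <| .casePair (.var 1) .nil <| .casePair (.var 1) .nil <|
  .ite (.frac
      (.sub (.call Proc.countLE (.pair (.pair (.var 7) (.var 0)) (.var 1)))
        (.call Proc.countLT (.pair (.pair (.var 7) (.var 2)) (.var 1)))) (.var 4))
    (.pair (.var 7) (.var 6)) (.var 6)

/-- Argument: a number `j` with `τ * j ≤ 1`. -/
def limit : Term :=
  .ite (.frac (.num 1) (.add (.var 0) (.num 1))) (.call Proc.limit (.add (.var 0) (.num 1)))
    (.var 0)

end Body

/-- All procedures. -/
def code : List Term :=
  [Body.merge, Body.counts, Body.length, Body.half, Body.median, Body.thirds, Body.above,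
    Body.below, Body.select, Body.reduce, Body.join, Body.sum, Body.size, Body.node, Body.rotL,
    Body.rotR, Body.balance, Body.lex, Body.insert, Body.delete, Body.from', Body.upto,
    Body.range, Body.countLE, Body.countLT, Body.verify, Body.limit]

/-- The data structure: two search trees with summaries, one ordered by coordinate and one by
color. -/
def summaryTrees : DynStructure where
  prog := code
  empty := .pair .nil .nil
  -- The parameter τ is accessible only through `frac`. The number ⌊1/τ⌋ is not stored but
  -- recomputed in each operation, which the O(1/τ) budget permits.
  insert := .casePair (.var 0) .nil <| .bind (.call Proc.limit (.num 0)) <|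
    .pair
      (.call Proc.insert (Term.tuple3 (.var 0) (.pair (.var 4) (.var 5)) (.var 1)))
      (.call Proc.insert (Term.tuple3 (.var 0) (.pair (.var 5) (.var 4)) (.var 2)))
  delete := .casePair (.var 0) .nil <| .bind (.call Proc.limit (.num 0)) <|
    -- The one-point interval [x, x] has a summary with a single counter. Its key is the color,
    -- without which the point cannot be located in the color tree.
    .casePair (.call Proc.range (Term.tuple4 (.var 0) (.var 4) (.var 4) (.var 1))) .nil <|
    .casePair (.var 1) .nil <| .casePair (.var 0) .nil <|
    .pair
      (.call Proc.delete (Term.tuple3 (.var 6) (.pair (.var 10) (.var 0)) (.var 7)))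
      (.call Proc.delete (Term.tuple3 (.var 6) (.pair (.var 0) (.var 10)) (.var 8)))
  query := .casePair (.var 0) .nil <| .bind (.call Proc.limit (.num 0)) <|
    .casePair (.call Proc.range (Term.tuple4 (.var 0) (.var 4) (.var 5) (.var 1))) .nil <|
    .call Proc.verify
      (.pair (Term.tuple4 (.var 0) (.var 6) (.var 7) (.var 4)) (.var 1))

/-- Bound for the number of steps of one activation of a procedure. -/
def activationCost : ℕ := 150

theorem nodes_le_of_mem_code : ∀ e ∈ code, e.nodes + 1 ≤ activationCost := by decide

/-! ### Running the machine -/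

theorem Val.ofTest_eq_one {α : Type u} {κ : Type v} {p : Prop} [Decidable p] :
    (Val.num 1 : Val α κ) = .ofTest p ↔ p := by
  unfold Val.ofTest; split_ifs with h <;> simp [h]

theorem Val.ofTest_eq_zero {α : Type u} {κ : Type v} {p : Prop} [Decidable p] :
    (Val.num 0 : Val α κ) = .ofTest p ↔ ¬ p := by
  unfold Val.ofTest; split_ifs with h <;> simp [h]

section Machine

variable {α : Type u} {κ : Type v} [LinearOrder α] [LinearOrder κ]

/-- The machine is deterministic. -/
theorem Eval.det {prog : List Term} {w : ℕ} {τ : ℝ} {env : List (Val α κ)} {e : Term}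
    {r r' : Val α κ} {t t' : ℕ} (h : Eval prog w τ env e r t) (h' : Eval prog w τ env e r' t') :
    r = r' ∧ t = t' := by
  induction h generalizing r' t' with
  | var h => cases h' with | var h' => simp_all
  | nil => cases h'; simp
  | num _ => cases h'; simp
  | pair _ _ iha ihb =>
    cases h' with | pair ha hb => obtain ⟨rfl, rfl⟩ := iha ha; obtain ⟨rfl, rfl⟩ := ihb hb; simp
  | caseNil _ _ iha ihb =>
    cases h' with
    | caseNil ha hb => obtain ⟨-, rfl⟩ := iha ha; obtain ⟨rfl, rfl⟩ := ihb hb; simp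
    | casePair ha hb => cases (iha ha).1
  | casePair _ _ iha ihb =>
    cases h' with
    | caseNil ha hb => cases (iha ha).1
    | casePair ha hb =>
      obtain ⟨h, rfl⟩ := iha ha; cases h; obtain ⟨rfl, rfl⟩ := ihb hb; simp
  | add _ _ _ iha ihb =>
    cases h' with
    | add ha hb _ =>
      obtain ⟨h, rfl⟩ := iha ha; cases h; obtain ⟨h, rfl⟩ := ihb hb; cases h; simp
  | sub _ _ iha ihb =>
    cases h' with
    | sub ha hb =>
      obtain ⟨h, rfl⟩ := iha ha; cases h; obtain ⟨h, rfl⟩ := ihb hb; cases h; simp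
  | leNum _ _ iha ihb | leKey _ _ iha ihb | leCol _ _ iha ihb =>
    cases h' with
    | leNum ha hb | leKey ha hb | leCol ha hb =>
      obtain ⟨h, rfl⟩ := iha ha; cases h; try (obtain ⟨h, rfl⟩ := ihb hb; cases h; simp)
  | frac _ _ iha ihb =>
    cases h' with
    | frac ha hb =>
      obtain ⟨h, rfl⟩ := iha ha; cases h; obtain ⟨h, rfl⟩ := ihb hb; cases h; simp
  | bind _ _ iha ihb =>
    cases h' with | bind ha hb => obtain ⟨rfl, rfl⟩ := iha ha; obtain ⟨rfl, rfl⟩ := ihb hb; simp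
  | iteTrue _ _ iha ihb =>
    cases h' with
    | iteTrue ha hb => obtain ⟨-, rfl⟩ := iha ha; obtain ⟨rfl, rfl⟩ := ihb hb; simp
    | iteFalse ha hb => have := (iha ha).1; simp at this
  | iteFalse _ _ iha ihb =>
    cases h' with
    | iteTrue ha hb => have := (iha ha).1; simp at this
    | iteFalse ha hb => obtain ⟨-, rfl⟩ := iha ha; obtain ⟨rfl, rfl⟩ := ihb hb; simp
  | call _ hf _ iha ihb =>
    cases h' with
    | call ha hf' hb =>
      obtain ⟨rfl, rfl⟩ := iha ha
      rw [hf] at hf'; cases hf'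
      obtain ⟨rfl, rfl⟩ := ihb hb; simp

/-- `Runs w τ env e r n`: the code `e` terminates with result `r`, and during its execution at
most `n` procedures are activated. -/
def Runs (w : ℕ) (τ : ℝ) (env : List (Val α κ)) (e : Term) (r : Val α κ) (n : ℕ) : Prop :=
  ∃ t, Eval code w τ env e r t ∧ t ≤ e.nodes + activationCost * n

/-- `Calls w τ f x r n`: procedure `f` with argument `x` terminates with result `r`, and the
number of activations, including this one, is at most `n`. -/
def Calls (w : ℕ) (τ : ℝ) (f : ℕ) (x r : Val α κ) (n : ℕ) : Prop :=
  ∃ e t, code[f]? = some e ∧ Eval code w τ [x] e r t ∧ t + 1 ≤ activationCost * n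

variable {w : ℕ} {τ : ℝ} {env : List (Val α κ)}

/-- The text of each body has fewer than `activationCost` nodes, so one more unit in the count of
activations pays for the body's own steps and for the call. -/
theorem Calls.intro {f : ℕ} {e : Term} {x r : Val α κ} {n N : ℕ} (hf : code[f]? = some e)
    (h : Runs w τ [x] e r n) (hN : n + 1 ≤ N) : Calls w τ f x r N := by
  obtain ⟨t, ht, hle⟩ := h
  refine ⟨e, t, hf, ht, ?_⟩
  have h1 := nodes_le_of_mem_code e (List.mem_of_getElem? hf)
  have h2 := Nat.mul_le_mul_left activationCost hN
  rw [Nat.mul_add] at h2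
  omega

theorem Runs.mono {e : Term} {r : Val α κ} {n N : ℕ} (h : Runs w τ env e r n) (hN : n ≤ N) :
    Runs w τ env e r N := by
  obtain ⟨t, ht, hle⟩ := h
  exact ⟨t, ht, hle.trans (by gcongr)⟩

theorem Runs.var {i : ℕ} {r : Val α κ} (h : env[i]? = some r) : Runs w τ env (.var i) r 0 :=
  ⟨1, .var h, by simp [Term.nodes]⟩

theorem Runs.nil : Runs w τ env .nil .nil 0 := ⟨1, .nil, by simp [Term.nodes]⟩

theorem Runs.num {n : ℕ} (h : n < 2 ^ w) : Runs w τ env (.num n) (.num n) 0 :=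
  ⟨1, .num h, by simp [Term.nodes]⟩

theorem Runs.pair {a b : Term} {x y : Val α κ} {m n : ℕ} (ha : Runs w τ env a x m)
    (hb : Runs w τ env b y n) : Runs w τ env (.pair a b) (.pair x y) (m + n) := by
  obtain ⟨s, hs, hs'⟩ := ha; obtain ⟨t, ht, ht'⟩ := hb
  exact ⟨_, .pair hs ht, by simp only [Term.nodes, Nat.mul_add]; omega⟩

theorem Runs.caseNil {e z c : Term} {r : Val α κ} {m n : ℕ} (he : Runs w τ env e .nil m)
    (hz : Runs w τ env z r n) : Runs w τ env (.casePair e z c) r (m + n) := by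
  obtain ⟨s, hs, hs'⟩ := he; obtain ⟨t, ht, ht'⟩ := hz
  exact ⟨_, .caseNil hs ht, by simp only [Term.nodes, Nat.mul_add]; omega⟩

theorem Runs.casePair {e z c : Term} {x y r : Val α κ} {m n : ℕ}
    (he : Runs w τ env e (.pair x y) m) (hc : Runs w τ (x :: y :: env) c r n) :
    Runs w τ env (.casePair e z c) r (m + n) := by
  obtain ⟨s, hs, hs'⟩ := he; obtain ⟨t, ht, ht'⟩ := hc
  exact ⟨_, .casePair hs ht, by simp only [Term.nodes, Nat.mul_add]; omega⟩

theorem Runs.add {a b : Term} {x y m n : ℕ} (ha : Runs w τ env a (.num x) m)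
    (hb : Runs w τ env b (.num y) n) (h : x + y < 2 ^ w) :
    Runs w τ env (.add a b) (.num (x + y)) (m + n) := by
  obtain ⟨s, hs, hs'⟩ := ha; obtain ⟨t, ht, ht'⟩ := hb
  exact ⟨_, .add hs ht h, by simp only [Term.nodes, Nat.mul_add]; omega⟩

theorem Runs.sub {a b : Term} {x y m n : ℕ} (ha : Runs w τ env a (.num x) m)
    (hb : Runs w τ env b (.num y) n) : Runs w τ env (.sub a b) (.num (x - y)) (m + n) := by
  obtain ⟨s, hs, hs'⟩ := ha; obtain ⟨t, ht, ht'⟩ := hb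
  exact ⟨_, .sub hs ht, by simp only [Term.nodes, Nat.mul_add]; omega⟩

theorem Runs.frac {a b : Term} {x y m n : ℕ} (ha : Runs w τ env a (.num x) m)
    (hb : Runs w τ env b (.num y) n) :
    Runs w τ env (.frac a b) (.ofTest (τ * (y : ℝ) ≤ (x : ℝ))) (m + n) := by
  obtain ⟨s, hs, hs'⟩ := ha; obtain ⟨t, ht, ht'⟩ := hb
  exact ⟨_, .frac hs ht, by simp only [Term.nodes, Nat.mul_add]; omega⟩

theorem Runs.bind {a b : Term} {x r : Val α κ} {m n : ℕ} (ha : Runs w τ env a x m)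
    (hb : Runs w τ (x :: env) b r n) : Runs w τ env (.bind a b) r (m + n) := by
  obtain ⟨s, hs, hs'⟩ := ha; obtain ⟨t, ht, ht'⟩ := hb
  exact ⟨_, .bind hs ht, by simp only [Term.nodes, Nat.mul_add]; omega⟩

/-- Each branch has to be run only under the outcome that selects it. Taking the maximum makes the
bound independent of the outcome. -/
theorem Runs.ite {p : Prop} [Decidable p] {c a b : Term} {r : Val α κ} {l m n : ℕ}
    (hc : Runs w τ env c (.ofTest p) l) (ha : p → Runs w τ env a r m)
    (hb : ¬ p → Runs w τ env b r n) : Runs w τ env (.ite c a b) r (l + max m n) := by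
  obtain ⟨s, hs, hs'⟩ := hc
  by_cases hp : p
  · obtain ⟨t, ht, ht'⟩ := (ha hp).mono (le_max_left m n)
    rw [Val.ofTest, if_pos hp] at hs
    exact ⟨_, .iteTrue hs ht, by simp only [Term.nodes, Nat.mul_add]; omega⟩
  · obtain ⟨t, ht, ht'⟩ := (hb hp).mono (le_max_right m n)
    rw [Val.ofTest, if_neg hp] at hs
    exact ⟨_, .iteFalse hs ht, by simp only [Term.nodes, Nat.mul_add]; omega⟩

/-- Closes the branch of a conditional that the known outcome of the test excludes. -/
theorem Runs.absurd {e : Term} {r : Val α κ} (h : False) : Runs w τ env e r 0 := h.elim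

theorem Runs.call {f : ℕ} {a : Term} {x r : Val α κ} {m n : ℕ} (ha : Runs w τ env a x m)
    (hf : Calls w τ f x r n) : Runs w τ env (.call f a) r (m + n) := by
  obtain ⟨s, hs, hs'⟩ := ha; obtain ⟨e, t, he, ht, ht'⟩ := hf
  exact ⟨_, .call hs he ht, by simp only [Term.nodes, Nat.mul_add]; omega⟩

theorem Runs.args2 {e : Term} {x y r : Val α κ} {n : ℕ} (h : Runs w τ [x, y, .pair x y] e r n) :
    Runs w τ [.pair x y] (.args2 e) r n :=
  (Runs.casePair (Runs.var rfl) h).mono (by omega)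

theorem Runs.args3 {e : Term} {x y z r : Val α κ} {n : ℕ}
    (h : Runs w τ [y, z, x, .pair y z, .pair x (.pair y z)] e r n) :
    Runs w τ [.pair x (.pair y z)] (.args3 e) r n :=
  Runs.args2 ((Runs.casePair (Runs.var rfl) h).mono (by omega))

theorem Runs.args4 {e : Term} {x y z u r : Val α κ} {n : ℕ}
    (h : Runs w τ [z, u, y, .pair z u, x, .pair y (.pair z u), .pair x (.pair y (.pair z u))]
      e r n) :
    Runs w τ [.pair x (.pair y (.pair z u))] (.args4 e) r n :=
  Runs.args3 ((Runs.casePair (Runs.var rfl) h).mono (by omega))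

theorem Runs.tuple3 {a b c : Term} {x y z : Val α κ} {l m n : ℕ} (ha : Runs w τ env a x l)
    (hb : Runs w τ env b y m) (hc : Runs w τ env c z n) :
    Runs w τ env (.tuple3 a b c) (.pair x (.pair y z)) (l + (m + n)) :=
  ha.pair (hb.pair hc)

theorem Runs.tuple4 {a b c d : Term} {x y z u : Val α κ} {k l m n : ℕ} (ha : Runs w τ env a x k)
    (hb : Runs w τ env b y l) (hc : Runs w τ env c z m) (hd : Runs w τ env d u n) :
    Runs w τ env (.tuple4 a b c d) (.pair x (.pair y (.pair z u))) (k + (l + (m + n))) :=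
  ha.pair (hb.pair (hc.pair hd))

/-- An embedding of an ordered set into the machine words, on which comparisons work. -/
class Atom {A : Type*} [LinearOrder A] (f : A → Val α κ) : Prop where
  size_eq : ∀ a, (f a).size = 1
  le {prog : List Term} {w : ℕ} {τ : ℝ} {env : List (Val α κ)} {a b : Term} {x y : A} {s t : ℕ} :
    Eval prog w τ env a (f x) s → Eval prog w τ env b (f y) t →
      Eval prog w τ env (.le a b) (.ofTest (x ≤ y)) (s + t + 1)

instance : Atom (Val.num : ℕ → Val α κ) := ⟨fun _ => rfl, Eval.leNum⟩

instance : Atom (Val.key : α → Val α κ) := ⟨fun _ => rfl, Eval.leKey⟩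

instance : Atom (Val.col : κ → Val α κ) := ⟨fun _ => rfl, Eval.leCol⟩

theorem Runs.le {A : Type*} [LinearOrder A] (f : A → Val α κ) [Atom f] {a b : Term} {x y : A}
    {m n : ℕ} (ha : Runs w τ env a (f x) m) (hb : Runs w τ env b (f y) n) :
    Runs w τ env (.le a b) (.ofTest (x ≤ y)) (m + n) := by
  obtain ⟨s, hs, hs'⟩ := ha; obtain ⟨t, ht, ht'⟩ := hb
  exact ⟨_, Atom.le hs ht, by simp only [Term.nodes, Nat.mul_add]; omega⟩

end Machine

/-! ### Selection in a list of numbers -/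

section Select

/-- The middle one of three numbers. -/
def median (x y z : ℕ) : ℕ :=
  if x ≤ y then if y ≤ z then y else if x ≤ z then z else x
  else if x ≤ z then x else if y ≤ z then z else y

/-- The medians of consecutive triples. -/
def thirds : List ℕ → List ℕ
  | x :: y :: z :: l => median x y z :: thirds l
  | _ => []

/-- `x` has rank `r` in `l`, counted from zero and from the largest element. -/
def IsNth (l : List ℕ) (r x : ℕ) : Prop :=
  l.countP (fun y => x < y) ≤ r ∧ r < l.countP (fun y => x ≤ y)

theorem length_thirds (l : List ℕ) : (thirds l).length = l.length / 3 := by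
  induction l using thirds.induct with
  | case1 x y z l ih => simp only [thirds, List.length_cons, ih]; omega
  | case2 l h =>
    match l, h with
    | [], _ => simp [thirds]
    | [_], _ => simp [thirds]
    | [_, _], _ => simp [thirds]
    | x :: y :: z :: l, h => exact (h x y z l rfl).elim

/-- If the median of a triple is at least p, then so are two of its three members. The next lemma is
the mirror image. -/
theorem two_mul_countP_thirds_ge (p : ℕ) (l : List ℕ) :
    2 * (thirds l).countP (fun y => p ≤ y) ≤ l.countP (fun y => p ≤ y) := by
  induction l using thirds.induct with
  | case1 x y z l ih =>
    simp only [thirds, List.countP_cons, median, decide_eq_true_eq]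
    split_ifs <;> omega
  | case2 l h => simp [thirds]

theorem two_mul_countP_thirds_le (p : ℕ) (l : List ℕ) :
    2 * (thirds l).countP (fun y => y ≤ p) ≤ l.countP (fun y => y ≤ p) := by
  induction l using thirds.induct with
  | case1 x y z l ih =>
    simp only [thirds, List.countP_cons, median, decide_eq_true_eq]
    split_ifs <;> omega
  | case2 l h => simp [thirds]

theorem countP_mono_ge (l : List ℕ) {x y : ℕ} (h : x ≤ y) :
    l.countP (fun z => y ≤ z) ≤ l.countP (fun z => x ≤ z) :=
  List.countP_mono_left fun z _ hz => by simp at hz ⊢; omega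

theorem countP_ge_le_gt (l : List ℕ) {x y : ℕ} (h : x < y) :
    l.countP (fun z => y ≤ z) ≤ l.countP (fun z => x < z) :=
  List.countP_mono_left fun z _ hz => by simp at hz ⊢; omega

theorem length_filter_gt (l : List ℕ) (p : ℕ) :
    (l.filter fun y => p < y).length = l.countP (fun y => p < y) :=
  List.countP_eq_length_filter.symm

theorem length_filter_lt_add (l : List ℕ) (p : ℕ) :
    (l.filter fun y => y < p).length + l.countP (fun y => p ≤ y) = l.length := by
  induction l with
  | nil => simp
  | cons y l ih =>
    rw [List.filter_cons, List.countP_cons, List.length_cons]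
    split_ifs <;> simp_all <;> omega

theorem countP_gt_add_countP_le (l : List ℕ) (p : ℕ) :
    l.countP (fun y => p < y) + l.countP (fun y => y ≤ p) = l.length := by
  induction l with
  | nil => simp
  | cons y l ih =>
    rw [List.countP_cons, List.countP_cons, List.length_cons]
    split_ifs <;> simp_all <;> omega

theorem countP_eq_filter_lt_add {l : List ℕ} {p : ℕ} {q : ℕ → Bool} (h : ∀ y, p ≤ y → q y) :
    l.countP q = (l.filter fun y => y < p).countP q + l.countP (fun y => p ≤ y) := by
  induction l with
  | nil => simp
  | cons y l ih =>
    rcases lt_or_ge y p with hy | hy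
    · simp [List.countP_cons, hy, ih, hy.not_ge]; omega
    · simp [hy.not_gt, ih, hy, h y hy]; omega

theorem countP_eq_filter_gt {l : List ℕ} {p : ℕ} {q : ℕ → Bool} (h : ∀ y, q y → p < y) :
    l.countP q = (l.filter fun y => p < y).countP q := by
  rw [List.countP_filter]
  refine List.countP_congr fun y _ => ?_
  have := h y
  simp only [Bool.and_eq_true, decide_eq_true_eq]
  tauto

/-- If x < y, all elements that are at least y exceed x, so the rank ranges of x and y are disjoint.
Thus `select` may find its answer in any way, as long as the answer has the right rank. -/
theorem IsNth.unique {l : List ℕ} {r x y : ℕ} (hx : IsNth l r x) (hy : IsNth l r y) : x = y := by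
  rcases lt_trichotomy x y with h | h | h
  · have := countP_ge_le_gt l h; have := hx.1; have := hy.2; omega
  · exact h
  · have := countP_ge_le_gt l h; have := hy.1; have := hx.2; omega

/-- More than r elements exceed p, so x does too, and the discarded elements do not affect the rank
of x from above. -/
theorem IsNth.above {l : List ℕ} {r x p : ℕ} (hx : IsNth l r x)
    (h : r < (l.filter fun y => p < y).length) : IsNth (l.filter fun y => p < y) r x := by
  have hp : p < x := by
    by_contra! hp
    rw [length_filter_gt] at h
    have : l.countP (fun y => p < y) ≤ l.countP (fun y => x < y) :=
      List.countP_mono_left fun z _ hz => by simp at hz ⊢; omega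
    have := hx.1
    omega
  refine ⟨?_, ?_⟩
  · rw [← countP_eq_filter_gt fun y hy => by simp at hy; omega]
    exact hx.1
  · rw [← countP_eq_filter_gt fun y hy => by simp at hy; omega]
    exact hx.2

/-- At most r elements would be at least p if x were not below p, a contradiction to the rank. The
discarded elements all lie above x, so the rank drops by their number. -/
theorem IsNth.below {l : List ℕ} {r x p : ℕ} (hx : IsNth l r x)
    (h : l.countP (fun y => p ≤ y) ≤ r) :
    IsNth (l.filter fun y => y < p) (r - l.countP (fun y => p ≤ y)) x := by
  have hp : x < p := by
    by_contra! hp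
    have := countP_mono_ge l hp
    have := hx.2
    omega
  have h1 := countP_eq_filter_lt_add (l := l) (p := p) (q := fun y => x < y)
    fun y hy => by simp; omega
  have h2 := countP_eq_filter_lt_add (l := l) (p := p) (q := fun y => x ≤ y)
    fun y hy => by simp; omega
  have := hx.1
  have := hx.2
  exact ⟨by omega, by omega⟩

theorem exists_countP_gt_le (l : List ℕ) (r : ℕ) : ∃ x, l.countP (fun y => x < y) ≤ r :=
  -- No element of a list of natural numbers exceeds the sum.
  ⟨l.sum, by
    rw [List.countP_eq_zero.2 fun y hy => by simpa using List.single_le_sum (by simp) y hy]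
    exact Nat.zero_le _⟩

/-- The element of rank `r`. -/
def nth (l : List ℕ) (r : ℕ) : ℕ := Nat.find (exists_countP_gt_le l r)

/-- By minimality of x = `nth l r`, more than r elements exceed x - 1, that is, are at least x. For
x = 0 all elements are at least x. -/
theorem isNth_nth {l : List ℕ} {r : ℕ} (h : r < l.length) : IsNth l r (nth l r) := by
  refine ⟨Nat.find_spec (exists_countP_gt_le l r), ?_⟩
  rcases Nat.eq_zero_or_pos (nth l r) with h0 | h0
  · simpa [h0] using h
  · have := Nat.find_min (exists_countP_gt_le l r) (m := nth l r - 1)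
      (by unfold nth at h0 ⊢; omega)
    refine (not_le.1 this).trans_le (List.countP_mono_left fun z _ hz => ?_)
    simp at hz ⊢; omega

/-- The median of medians is a good pivot. -/
theorem length_filter_le_of_isNth {l : List ℕ} {p : ℕ}
    (h : IsNth (thirds (thirds l)) ((thirds (thirds l)).length / 2) p) :
    (l.filter fun y => p < y).length + 2 * (l.length / 9) ≤ l.length ∧
      (l.filter fun y => y < p).length + 2 * (l.length / 9) ≤ l.length := by
  have hq : (thirds (thirds l)).length = l.length / 9 := by
    rw [length_thirds, length_thirds, Nat.div_div_eq_div_mul]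
  -- At least half of the ⌊n/9⌋ nested medians lie on each side of p, with equality allowed. Each
  -- stands for four elements of the list on that side, two per level, which makes at least 2⌊n/9⌋.
  have a1 := two_mul_countP_thirds_ge p l
  have a2 := two_mul_countP_thirds_ge p (thirds l)
  have b1 := two_mul_countP_thirds_le p l
  have b2 := two_mul_countP_thirds_le p (thirds l)
  have c1 := length_filter_lt_add l p
  have c2 := countP_gt_add_countP_le l p
  have c3 := countP_gt_add_countP_le (thirds (thirds l)) p
  have h1 := h.1
  have h2 := h.2
  rw [length_filter_gt]
  omega

end Select

/-! ### Misra-Gries summaries -/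

section Summary

variable {B : Type*} [LinearOrder B]

/-- A summary of a multiset: its size, and a sorted list of elements with counters. -/
abbrev Summary (B : Type*) := ℕ × List (B × ℕ)

/-- Merge two association lists, adding the counters of equal keys. -/
def mergeCounts : List (B × ℕ) → List (B × ℕ) → List (B × ℕ)
  | [], l => l
  | (a, m) :: l, [] => (a, m) :: l
  | (a, m) :: l, (b, n) :: l' =>
    if a ≤ b then
      if b ≤ a then (a, m + n) :: mergeCounts l l' else (a, m) :: mergeCounts l ((b, n) :: l')
    else (b, n) :: mergeCounts ((a, m) :: l) l'
  termination_by l l' => l.length + l'.length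

/-- Subtract `x` from all counters and keep the positive ones. -/
def reduceCounts (x : ℕ) : List (B × ℕ) → List (B × ℕ)
  | [] => []
  | (a, m) :: l => if m ≤ x then reduceCounts x l else (a, m - x) :: reduceCounts x l

/-- Reduce the number of counters to `m`. -/
def prune (m : ℕ) (l : List (B × ℕ)) : List (B × ℕ) :=
  if l.length ≤ m then l else reduceCounts (nth (l.map Prod.snd) m) l

/-- The summary of a union. -/
def Summary.join (m : ℕ) (s s' : Summary B) : Summary B :=
  (s.1 + s'.1, prune m (mergeCounts s.2 s'.2))

/-- The sum of all counters. -/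
def total (l : List (B × ℕ)) : ℕ := (l.map Prod.snd).sum

/-- The counter of a color. -/
def counter (l : List (B × ℕ)) (c : B) : ℕ := total (l.filter fun e => e.1 = c)

end Summary

/-! ### Machine runs of selection and of the operations on summaries -/

section Refine

variable {α : Type u} {κ : Type v} [LinearOrder α] [LinearOrder κ]
variable {B : Type*} [LinearOrder B]

/-- The linked list of the given numbers. -/
def Val.ofNums : List ℕ → Val α κ
  | [] => nil
  | x :: l => pair (num x) (ofNums l)

/-- The linked list of the given counters. -/
def Val.ofCounts (f : B → Val α κ) : List (B × ℕ) → Val α κ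
  | [] => nil
  | (a, m) :: l => pair (pair (f a) (num m)) (ofCounts f l)

def Val.ofSummary (f : B → Val α κ) (s : Summary B) : Val α κ := pair (num s.1) (ofCounts f s.2)

variable {w : ℕ} {τ : ℝ}

theorem calls_length (l : List ℕ) (h : l.length < 2 ^ w) :
    Calls (α := α) (κ := κ) w τ Proc.length (.ofNums l) (.num l.length) (l.length + 1) := by
  induction l with
  | nil => exact .intro rfl (.caseNil (.var rfl) (.num (by positivity))) (by omega)
  | cons x l ih =>
    rw [List.length_cons] at h
    rw [List.length_cons, add_comm l.length 1]
    exact .intro rfl (.casePair (.var rfl) (.add (.num (by omega))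
      (.call (.var rfl) (ih (by omega))) (by omega))) (by omega)

theorem calls_half (l : List ℕ) (h : l.length < 2 ^ w) :
    Calls (α := α) (κ := κ) w τ Proc.half (.ofNums l) (.num (l.length / 2)) (l.length + 1) := by
  match l with
  | [] => exact .intro rfl (.caseNil (.var rfl) (.num (by positivity))) (by simp)
  | [x] =>
    rw [show [x].length / 2 = 0 by simp]
    exact .intro rfl (.casePair (.var rfl) (.caseNil (.var rfl) (.num (by positivity)))) (by simp)
  | x :: y :: l =>
    simp only [List.length_cons] at h ⊢
    rw [show (l.length + 1 + 1) / 2 = 1 + l.length / 2 by omega]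
    exact .intro rfl (.casePair (.var rfl) (.casePair (.var rfl) (.add (.num (by omega))
      (.call (.var rfl) (calls_half l (by omega))) (by omega)))) (by omega)

theorem calls_median (x y z : ℕ) :
    Calls (α := α) (κ := κ) w τ Proc.median (.pair (.num x) (.pair (.num y) (.num z)))
      (.num (median x y z)) 1 := by
  refine .intro rfl (.args3 (.ite (.le .num (.var rfl) (.var rfl))
    (fun h1 => .ite (.le .num (.var rfl) (.var rfl))
      (fun h2 => by rw [median, if_pos h1, if_pos h2]; exact .var rfl)
      fun h2 => .ite (.le .num (.var rfl) (.var rfl))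
        (fun h3 => by rw [median, if_pos h1, if_neg h2, if_pos h3]; exact .var rfl)
        fun h3 => by rw [median, if_pos h1, if_neg h2, if_neg h3]; exact .var rfl)
    fun h1 => .ite (.le .num (.var rfl) (.var rfl))
      (fun h2 => by rw [median, if_neg h1, if_pos h2]; exact .var rfl)
      fun h2 => .ite (.le .num (.var rfl) (.var rfl))
        (fun h3 => by rw [median, if_neg h1, if_neg h2, if_pos h3]; exact .var rfl)
        fun h3 => by rw [median, if_neg h1, if_neg h2, if_neg h3]; exact .var rfl)) (by omega)

theorem calls_thirds (l : List ℕ) :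
    Calls (α := α) (κ := κ) w τ Proc.thirds (.ofNums l) (.ofNums (thirds l)) (l.length + 1) := by
  match l with
  | [] => exact .intro rfl (.caseNil (.var rfl) .nil) (by omega)
  | [x] => exact .intro rfl (.casePair (.var rfl) (.caseNil (.var rfl) .nil)) (by omega)
  | [x, y] =>
    exact .intro rfl (.casePair (.var rfl) (.casePair (.var rfl) (.caseNil (.var rfl) .nil)))
      (by omega)
  | x :: y :: z :: l =>
    refine .intro rfl (.casePair (.var rfl) (.casePair (.var rfl) (.casePair (.var rfl) (.pair
      (.call (.tuple3 (.var rfl) (.var rfl) (.var rfl)) (calls_median x y z))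
      (.call (.var rfl) (calls_thirds l)))))) ?_
    simp only [List.length_cons]; omega

theorem calls_above (p : ℕ) (l : List ℕ) :
    Calls (α := α) (κ := κ) w τ Proc.above (.pair (.num p) (.ofNums l))
      (.ofNums (l.filter fun y => p < y)) (l.length + 1) := by
  induction l with
  | nil => exact .intro rfl (.args2 (.caseNil (.var rfl) .nil)) (by omega)
  | cons x l ih =>
    refine .intro rfl (.args2 (.casePair (.var rfl) (.ite (.le .num (.var rfl) (.var rfl))
      (fun h => by
        rw [List.filter_cons_of_neg (by simpa using h)]
        exact .call (.pair (.var rfl) (.var rfl)) ih)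
      fun h => by
        rw [List.filter_cons_of_pos (by simpa using h)]
        exact .pair (.var rfl) (.call (.pair (.var rfl) (.var rfl)) ih))))
      (by simp only [List.length_cons]; omega)

theorem calls_below (p : ℕ) (l : List ℕ) :
    Calls (α := α) (κ := κ) w τ Proc.below (.pair (.num p) (.ofNums l))
      (.ofNums (l.filter fun y => y < p)) (l.length + 1) := by
  induction l with
  | nil => exact .intro rfl (.args2 (.caseNil (.var rfl) .nil)) (by omega)
  | cons x l ih =>
    refine .intro rfl (.args2 (.casePair (.var rfl) (.ite (.le .num (.var rfl) (.var rfl))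
      (fun h => by
        rw [List.filter_cons_of_neg (by simpa using h)]
        exact .call (.pair (.var rfl) (.var rfl)) ih)
      fun h => by
        rw [List.filter_cons_of_pos (by simpa using h)]
        exact .pair (.var rfl) (.call (.pair (.var rfl) (.var rfl)) ih))))
      (by simp only [List.length_cons]; omega)

/-- The number of activations of a selection among `n` numbers. -/
def selectCost (n : ℕ) : ℕ := 162 * n

/-- One recursive call handles the ⌊n/9⌋ nested medians, the other at most n - 2⌊n/9⌋ numbers. Since
1/9 + 7/9 < 1, the cost is linear. Grouping into triples only once would leave the fractions 1/3 and
2/3, whose sum is 1. -/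
theorem calls_select {l : List ℕ} {r x : ℕ} (hx : IsNth l r x) (h : l.length < 2 ^ w) :
    Calls (α := α) (κ := κ) w τ Proc.select (.pair (.ofNums l) (.num r)) (.num x)
      (selectCost l.length) := by
  induction hn : l.length using Nat.strong_induction_on generalizing l r x with
  | _ n ih =>
  subst hn
  have hr : r < l.length := hx.2.trans_le List.countP_le_length
  have h9 : (thirds (thirds l)).length = l.length / 9 := by
    rw [length_thirds, length_thirds, Nat.div_div_eq_div_mul]
  have hlo (p : ℕ) := length_filter_lt_add l p
  -- the pivot
  obtain ⟨p, k, hp, hk⟩ : ∃ p k, Runs (α := α) (κ := κ) w τ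
      [.ofNums (thirds (thirds l)), .ofNums l, .num r, .pair (.ofNums l) (.num r)]
      (.casePair (.var 0) (.casePair (.var 1) (.num 0) (.var 0))
        (.call Proc.select (.pair (.var 2) (.call Proc.half (.var 2))))) (.num p) k ∧
      ∀ l', l' = (l.filter fun y => p < y) ∨ l' = (l.filter fun y => y < p) →
        l'.length < l.length ∧ k + selectCost l'.length + 8 * l.length + 8 ≤
          selectCost l.length := by
    rcases hq : thirds (thirds l) with _ | ⟨y, q⟩
    -- Here n ≤ 8. The head serves as pivot and belongs to neither strict part, so each part is
    -- shorter and the saved 162 units cover the linear work.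
    · rcases l with _ | ⟨z, l⟩
      · simp at hr
      · refine ⟨z, _, .caseNil (.var rfl) (.casePair (.var rfl) (.var rfl)), fun l' hl' => ?_⟩
        have : l'.length ≤ l.length := by
          rcases hl' with rfl | rfl <;> simp [List.length_filter_le]
        rw [hq] at h9
        simp only [List.length_cons, List.length_nil, selectCost] at *
        omega
    · rw [← hq]
      have hpos : 0 < l.length / 9 := by rw [← h9, hq]; simp
      have hlt : (thirds (thirds l)).length / 2 < (thirds (thirds l)).length := by omega
      refine ⟨_, _, .casePair (x := .num y) (y := .ofNums q) (.var (by rw [hq]; rfl))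
        (.call (.pair (.var rfl) (.call (.var rfl) (calls_half _ (by omega))))
          (ih _ (by omega) (isNth_nth hlt) (by omega) rfl)), fun l' hl' => ?_⟩
      have hlen := length_filter_le_of_isNth (isNth_nth hlt)
      rw [h9] at *
      have : l'.length + 2 * (l.length / 9) ≤ l.length := by
        rcases hl' with rfl | rfl
        exacts [hlen.1, hlen.2]
      -- With q = ⌊n/9⌋ ≥ 1 this amounts to 161q ≥ 8n + 9, which follows from n ≤ 9q + 8.
      simp only [selectCost]
      omega
  have hhi := hk _ (.inl rfl)
  have hlo' := hk _ (.inr rfl)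
  have hl1 := length_thirds l
  have hsub : l.length - (l.filter fun y => y < p).length = l.countP (fun y => p ≤ y) := by
    have := hlo p; omega
  refine .intro rfl (.args2 (.bind (.call (.call (.var rfl) (calls_thirds _)) (calls_thirds _))
    (.bind hp
    (.bind (.call (.pair (.var rfl) (.var rfl)) (calls_above _ _))
    (.bind (.call (.pair (.var rfl) (.var rfl)) (calls_below _ _))
    (.bind (.call (.var rfl) (calls_length _ (by omega)))
    (.bind (.sub (.call (.var rfl) (calls_length _ (by omega)))
      (.call (.var rfl) (calls_length _ (by omega))))
    (.ite (.le .num (.var rfl) (.var rfl))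
      (fun h1 => .ite (.le .num (.var rfl) (.var rfl))
        (fun h2 => .call (.pair (.var rfl) (.sub (.var rfl) (.var rfl)))
          (ih _ hlo'.1 (by rw [hsub] at h2 ⊢; exact hx.below h2) (by omega) rfl))
        -- The rank lies between the number of elements above p and the number of those at least p,
        -- so the pivot is the element sought.
        (fun h2 => by
          have : IsNth l r p := ⟨by rwa [length_filter_gt] at h1, by omega⟩
          rw [hx.unique this]
          exact .var rfl))
      (fun h1 => .call (.pair (.var rfl) (.var rfl))
        (ih _ hhi.1 (hx.above (not_le.1 h1)) (by omega) rfl))))))))))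
    (by omega)

omit [LinearOrder B] in
theorem calls_counts (f : B → Val α κ) (l : List (B × ℕ)) :
    Calls w τ Proc.counts (.ofCounts f l) (.ofNums (l.map Prod.snd)) (l.length + 1) := by
  induction l with
  | nil => exact .intro rfl (.caseNil (.var rfl) .nil) (by omega)
  | cons e l ih =>
    exact .intro rfl (.casePair (.var rfl) (.pair (.casePair (.var rfl) (.var rfl))
      (.call (.var rfl) ih))) (by simp only [List.length_cons]; omega)

omit [LinearOrder B] in
theorem calls_reduce (f : B → Val α κ) (x : ℕ) (l : List (B × ℕ)) :
    Calls w τ Proc.reduce (.pair (.num x) (.ofCounts f l)) (.ofCounts f (reduceCounts x l))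
      (l.length + 1) := by
  induction l with
  | nil => exact .intro rfl (.args2 (.caseNil (.var rfl) .nil)) (by omega)
  | cons e l ih =>
    exact .intro rfl (.args2 (.casePair (.var rfl) (.casePair (.var rfl)
      (.ite (.le .num (.var rfl) (.var rfl))
        (fun h => by
          rw [reduceCounts, if_pos h]
          exact .call (.pair (.var rfl) (.var rfl)) ih)
        fun h => by
          rw [reduceCounts, if_neg h]
          exact .pair (.pair (.var rfl) (.sub (.var rfl) (.var rfl)))
            (.call (.pair (.var rfl) (.var rfl)) ih)))))
      (by simp only [List.length_cons]; omega)

omit [LinearOrder B] in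
theorem total_cons (e : B × ℕ) (l : List (B × ℕ)) : total (e :: l) = e.2 + total l := by
  simp [total]

/-- The bound on the totals ensures that every sum of two counters fits into a word. It is inherited
by the tails of the lists. -/
theorem calls_merge (f : B → Val α κ) [Atom f] (l l' : List (B × ℕ))
    (h : total l + total l' < 2 ^ w) :
    Calls w τ Proc.merge (.pair (.ofCounts f l) (.ofCounts f l'))
      (.ofCounts f (mergeCounts l l')) (l.length + l'.length + 1) := by
  induction l, l' using mergeCounts.induct with
  | case1 l =>
    rw [mergeCounts]
    exact .intro rfl (.args2 (.caseNil (.var rfl) (.var rfl))) (by omega)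
  | case2 a m l =>
    rw [mergeCounts]
    exact .intro rfl (.args2 (.casePair (.var rfl) (.caseNil (.var rfl) (.var rfl)))) (by omega)
  | case3 a m l b n l' h1 h2 ih =>
    simp only [total_cons] at *
    rw [mergeCounts, if_pos h1, if_pos h2]
    exact .intro rfl (.args2 (.casePair (.var rfl) (.casePair (.var rfl) (.casePair (.var rfl)
      (.casePair (.var rfl) (.ite (.le f (.var rfl) (.var rfl))
        (fun _ => .ite (.le f (.var rfl) (.var rfl))
          (fun _ => .pair (.pair (.var rfl) (.add (.var rfl) (.var rfl) (by omega)))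
            (.call (.pair (.var rfl) (.var rfl)) (ih (by omega))))
          fun h => .absurd (h h2)) fun h => .absurd (h h1))))))) (by simp; omega)
  | case4 a m l b n l' h1 h2 ih => 
    simp only [total_cons] at *
    rw [mergeCounts, if_pos h1, if_neg h2]
    exact .intro rfl (.args2 (.casePair (.var rfl) (.casePair (.var rfl) (.casePair (.var rfl)
      (.casePair (.var rfl) (.ite (.le f (.var rfl) (.var rfl))
        (fun _ => .ite (.le f (.var rfl) (.var rfl))
          (fun h => .absurd (h2 h))
          fun h => .pair (.var rfl) (.call (.pair (.var rfl) (.var rfl)) (ih (by omega))))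
          fun h => .absurd (h h1))))))) (by simp)
  | case5 a m l b n l' h1 ih =>
    simp only [total_cons] at *
    rw [mergeCounts, if_neg h1]
    exact .intro rfl (.args2 (.casePair (.var rfl) (.casePair (.var rfl) (.casePair (.var rfl)
      (.casePair (.var rfl) (.ite (.le f (.var rfl) (.var rfl))
        (fun h => .absurd (h1 h))
        fun h => .pair (.var rfl) (.call (.pair (.var rfl) (.var rfl)) (ih (by omega)))))))))
          (by simp)

theorem length_mergeCounts_le (l l' : List (B × ℕ)) :
    (mergeCounts l l').length ≤ l.length + l'.length := by
  induction l, l' using mergeCounts.induct with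
  | case1 l => simp [mergeCounts]
  | case2 a m l => simp [mergeCounts]
  | case3 a m l b n l' h1 h2 ih => 
    rw [mergeCounts, if_pos h1, if_pos h2]; simp only [List.length_cons]; omega
  | case4 a m l b n l' h1 h2 ih => 
    rw [mergeCounts, if_pos h1, if_neg h2]; simp only [List.length_cons] at *; omega
  | case5 a m l b n l' h1 ih =>
    rw [mergeCounts, if_neg h1]; simp only [List.length_cons] at *; omega

/-- The number of activations for joining two summaries of at most `m` counters. -/
def joinCost (m : ℕ) : ℕ := 332 * m + 6

theorem calls_join (f : B → Val α κ) [Atom f] (m : ℕ) (s s' : Summary B)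
    (h : total s.2 + total s'.2 < 2 ^ w) (h' : s.1 + s'.1 < 2 ^ w) (hm : 2 * m < 2 ^ w)
    (hs : s.2.length ≤ m) (hs' : s'.2.length ≤ m) :
    Calls w τ Proc.join (.pair (.num m) (.pair (.ofSummary f s) (.ofSummary f s')))
      (.ofSummary f (s.join m s')) (joinCost m) := by
  have hlen := length_mergeCounts_le s.2 s'.2
  have hc : ((mergeCounts s.2 s'.2).map Prod.snd).length = (mergeCounts s.2 s'.2).length := by simp
  refine .intro rfl (.args3 (.casePair (.var rfl) (.casePair (.var rfl) (.pair
    (.add (.var rfl) (.var rfl) h')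
    (.bind (.call (.pair (.var rfl) (.var rfl)) (calls_merge f _ _ h))
    (.bind (.call (.var rfl) (calls_counts f _))
    (.ite (.le .num (.call (.var rfl) (calls_length _ (by omega))) (.var rfl))
      (fun h1 => by
        change Runs w τ _ _ (.ofCounts f (prune m (mergeCounts s.2 s'.2))) _
        rw [prune, if_pos (by omega)]
        exact .var rfl)
      fun h1 => by
        change Runs w τ _ _ (.ofCounts f (prune m (mergeCounts s.2 s'.2))) _
        rw [prune, if_neg (by omega)]
        exact .call (.pair (.call (.pair (.var rfl) (.var rfl))
          (calls_select (isNth_nth (by omega)) (by omega))) (.var rfl)) (calls_reduce f _ _))))))))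
    -- The merged list has at most 2m entries. Four linear passes over it cost 8m + 4, the selection
    -- costs 162 · 2m, and there is the activation of `join` itself.
    (by simp only [selectCost, joinCost, hc]; omega)

end Refine

/-! ### Correctness of summaries -/

section Summary

variable {B : Type*} [LinearOrder B]

theorem counter_cons (e : B × ℕ) (l : List (B × ℕ)) (c : B) :
    counter (e :: l) c = (if e.1 = c then e.2 else 0) + counter l c := by
  unfold counter
  split_ifs with h
  · rw [List.filter_cons_of_pos (by simpa using h), total_cons]
  · rw [List.filter_cons_of_neg (by simpa using h), zero_add]

theorem total_mergeCounts (l l' : List (B × ℕ)) :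
    total (mergeCounts l l') = total l + total l' := by
  induction l, l' using mergeCounts.induct with
  | case1 l => simp [mergeCounts, total]
  | case2 a m l => simp [mergeCounts, total]
  | case3 a m l b n l' h1 h2 ih =>
    rw [mergeCounts, if_pos h1, if_pos h2]; simp only [total_cons] at *; omega
  | case4 a m l b n l' h1 h2 ih =>
    rw [mergeCounts, if_pos h1, if_neg h2]; simp only [total_cons] at *; omega
  | case5 a m l b n l' h1 ih =>
    rw [mergeCounts, if_neg h1]; simp only [total_cons] at *; omega

theorem counter_mergeCounts (l l' : List (B × ℕ)) (c : B) :
    counter (mergeCounts l l') c = counter l c + counter l' c := by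
  induction l, l' using mergeCounts.induct with
  | case1 l => simp [mergeCounts, total, counter]
  | case2 a m l => simp [mergeCounts, total, counter]
  | case3 a m l b n l' h1 h2 ih =>
    obtain rfl := le_antisymm h1 h2
    rw [mergeCounts, if_pos h1, if_pos h2]; simp only [counter_cons] at *; split_ifs <;> omega
  | case4 a m l b n l' h1 h2 ih =>
    rw [mergeCounts, if_pos h1, if_neg h2]; simp only [counter_cons] at *; omega
  | case5 a m l b n l' h1 ih =>
    rw [mergeCounts, if_neg h1]; simp only [counter_cons] at *; omega

theorem mem_map_fst_mergeCounts {l l' : List (B × ℕ)} {c : B}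
    (h : c ∈ (mergeCounts l l').map Prod.fst) :
    c ∈ l.map Prod.fst ∨ c ∈ l'.map Prod.fst := by
  induction l, l' using mergeCounts.induct with
  | case1 l => rw [mergeCounts] at h; exact .inr h
  | case2 a m l => rw [mergeCounts] at h; exact .inl h
  | case3 a m l b n l' h1 h2 ih =>
    rw [mergeCounts, if_pos h1, if_pos h2] at h
    simp only [List.map_cons, List.mem_cons] at *; tauto
  | case4 a m l b n l' h1 h2 ih =>
    rw [mergeCounts, if_pos h1, if_neg h2] at h
    simp only [List.map_cons, List.mem_cons] at *; tauto
  | case5 a m l b n l' h1 ih =>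
    rw [mergeCounts, if_neg h1] at h
    simp only [List.map_cons, List.mem_cons] at *; tauto

theorem pairwise_mergeCounts {l l' : List (B × ℕ)} (h : (l.map Prod.fst).Pairwise (· < ·))
    (h' : (l'.map Prod.fst).Pairwise (· < ·)) :
    ((mergeCounts l l').map Prod.fst).Pairwise (· < ·) := by
  induction l, l' using mergeCounts.induct with
  | case1 l => rwa [mergeCounts]
  | case2 a m l => rwa [mergeCounts]
  | case3 a m l b n l' h1 h2 ih =>
    obtain rfl := le_antisymm h1 h2
    rw [mergeCounts, if_pos h1, if_pos h2]
    simp only [List.map_cons, List.pairwise_cons] at *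
    refine ⟨fun c hc => ?_, ih h.2 h'.2⟩
    rcases mem_map_fst_mergeCounts hc with hc | hc
    exacts [h.1 c hc, h'.1 c hc]
  | case4 a m l b n l' h1 h2 ih =>
    rw [mergeCounts, if_pos h1, if_neg h2]
    have hab := not_le.1 h2
    simp only [List.map_cons, List.pairwise_cons] at *
    refine ⟨fun c hc => ?_, ih h.2 h'⟩
    rcases mem_map_fst_mergeCounts hc with hc | hc
    · exact h.1 c hc
    · rw [List.map_cons, List.mem_cons] at hc
      rcases hc with rfl | hc
      exacts [hab, hab.trans (h'.1 c hc)]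
  | case5 a m l b n l' h1 ih =>
    rw [mergeCounts, if_neg h1]
    have hab := not_le.1 h1
    simp only [List.map_cons, List.pairwise_cons] at *
    refine ⟨fun c hc => ?_, ih h h'.2⟩
    rcases mem_map_fst_mergeCounts hc with hc | hc
    · rw [List.map_cons, List.mem_cons] at hc
      rcases hc with rfl | hc
      exacts [hab, hab.trans (h.1 c hc)]
    · exact h'.1 c hc

theorem pos_of_mem_mergeCounts {l l' : List (B × ℕ)} (h : ∀ e ∈ l, 0 < e.2)
    (h' : ∀ e ∈ l', 0 < e.2) : ∀ e ∈ mergeCounts l l', 0 < e.2 := by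
  induction l, l' using mergeCounts.induct with
  | case1 l => rwa [mergeCounts]
  | case2 a m l => rwa [mergeCounts]
  | case3 a m l b n l' h1 h2 ih =>
    rw [mergeCounts, if_pos h1, if_pos h2]
    simp only [List.forall_mem_cons] at *
    exact ⟨by omega, ih h.2 h'.2⟩
  | case4 a m l b n l' h1 h2 ih =>
    rw [mergeCounts, if_pos h1, if_neg h2]
    simp only [List.forall_mem_cons] at *
    exact ⟨h.1, ih h.2 h'⟩
  | case5 a m l b n l' h1 ih =>
    rw [mergeCounts, if_neg h1]
    simp only [List.forall_mem_cons] at *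
    exact ⟨h'.1, ih h h'.2⟩

omit [LinearOrder B] in
theorem length_reduceCounts (x : ℕ) (l : List (B × ℕ)) :
    (reduceCounts x l).length = (l.map Prod.snd).countP (fun y => x < y) := by
  induction l with
  | nil => rfl
  | cons e l ih =>
    rw [reduceCounts, List.map_cons, List.countP_cons]
    split_ifs <;> simp_all; omega

omit [LinearOrder B] in
-- Every counter that is at least x loses exactly x. This gain in the total compensates for the
-- error that the subtraction causes in single counters.
theorem total_reduceCounts_le (x : ℕ) (l : List (B × ℕ)) :
    total (reduceCounts x l) + (l.map Prod.snd).countP (fun y => x ≤ y) * x ≤ total l := by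
  induction l with
  | nil => simp [reduceCounts, total]
  | cons e l ih =>
    rw [reduceCounts, List.map_cons, List.countP_cons, add_mul, total_cons]
    simp only [decide_eq_true_eq, ite_mul, one_mul, zero_mul]
    split_ifs <;> try simp only [total_cons]
    all_goals omega

omit [LinearOrder B] in
theorem map_fst_reduceCounts_sublist (x : ℕ) (l : List (B × ℕ)) :
    ((reduceCounts x l).map Prod.fst).Sublist (l.map Prod.fst) := by
  induction l with
  | nil => exact .slnil
  | cons e l ih =>
    rw [reduceCounts]
    split_ifs
    exacts [.cons _ ih, .cons_cons _ ih]

omit [LinearOrder B] in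
theorem pos_of_mem_reduceCounts (x : ℕ) (l : List (B × ℕ)) :
    ∀ e ∈ reduceCounts x l, 0 < e.2 := by
  induction l with
  | nil => simp [reduceCounts]
  | cons e l ih =>
    rw [reduceCounts]
    split_ifs with h
    · exact ih
    · rw [List.forall_mem_cons]
      exact ⟨Nat.sub_pos_of_lt (not_le.1 h), ih⟩

theorem counter_eq_zero {l : List (B × ℕ)} {c : B} (h : c ∉ l.map Prod.fst) :
    counter l c = 0 := by
  induction l with
  | nil => rfl
  | cons e l ih =>
    rw [List.map_cons, List.mem_cons, not_or] at h
    rw [counter_cons, if_neg (Ne.symm h.1), ih h.2]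

/-- Strictly sorted keys are distinct, so a color has at most one entry and x is subtracted from it
at most once. -/
theorem counter_le_reduceCounts_add (x : ℕ) {l : List (B × ℕ)}
    (h : (l.map Prod.fst).Pairwise (· < ·)) (c : B) :
    counter l c ≤ counter (reduceCounts x l) c + x := by
  induction l with
  | nil => simp [counter, total]
  | cons e l ih =>
    rw [List.map_cons, List.pairwise_cons] at h
    have ih := ih h.2
    rw [reduceCounts, counter_cons]
    by_cases hc : e.1 = c
    · have hz : counter l c = 0 := counter_eq_zero fun hl => (h.1 c hl).ne hc
      split_ifs
      · omega
      · rw [counter_cons, if_pos hc]; omega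
    · rw [if_neg hc]
      split_ifs
      · omega
      · rw [counter_cons, if_neg hc]; omega

/-- The summary `s` has at most `m` counters and describes the list `L`: an element of `L` that
occurs in more than a `1 / (m + 1)`-fraction of `L` has a counter. -/
structure Summary.Describes (m : ℕ) (s : Summary B) (L : List B) : Prop where
  size_eq : s.1 = L.length
  sorted : (s.2.map Prod.fst).Pairwise (· < ·)
  length_le : s.2.length ≤ m
  pos : ∀ e ∈ s.2, 0 < e.2
  total_le : total s.2 ≤ L.length
  count_le : ∀ c, (m + 1) * L.count c + total s.2 ≤ L.length + (m + 1) * counter s.2 c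

namespace Summary.Describes

variable {m : ℕ} {s s' : Summary B} {L L' : List B}

theorem perm (h : s.Describes m L) (hp : L.Perm L') : s.Describes m L' where
  size_eq := h.size_eq.trans hp.length_eq
  sorted := h.sorted
  length_le := h.length_le
  pos := h.pos
  total_le := hp.length_eq ▸ h.total_le
  count_le c := by rw [← hp.length_eq, ← hp.count_eq]; exact h.count_le c

theorem empty : Summary.Describes m ((0, []) : Summary B) [] :=
  ⟨rfl, .nil, by simp, by simp, by simp [total], by simp [total]⟩

theorem singleton (hm : 1 ≤ m) (b : B) : Summary.Describes m ((1, [(b, 1)]) : Summary B) [b] where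
  size_eq := rfl
  sorted := by simp
  length_le := by simpa using hm
  pos := by simp
  total_le := by simp [total]
  count_le c := by
    rw [counter_cons, List.count_singleton]
    by_cases h : b = c <;> simp [h, total, counter]

/-- The inequalities of the two parts add up. If x, the counter of rank m, is subtracted, at most m
counters exceed x and survive, and at least m + 1 counters are at least x. Thus the total drops by
at least (m+1)x, while (m+1) times a single counter drops by at most (m+1)x. -/
theorem join (h : s.Describes m L) (h' : s'.Describes m L') :
    (s.join m s').Describes m (L ++ L') := by
  have ht := total_mergeCounts s.2 s'.2
  have hs := pairwise_mergeCounts h.sorted h'.sorted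
  have hp := pos_of_mem_mergeCounts h.pos h'.pos
  have hle := h.total_le
  have hle' := h'.total_le
  have hc (c : B) : (m + 1) * (L ++ L').count c + total (mergeCounts s.2 s'.2) ≤
      (L ++ L').length + (m + 1) * counter (mergeCounts s.2 s'.2) c := by
    have h1 := h.count_le c
    have h2 := h'.count_le c
    rw [ht, counter_mergeCounts, List.count_append, List.length_append, mul_add, mul_add]
    omega
  have hsize : s.1 + s'.1 = (L ++ L').length := by
    rw [List.length_append, h.size_eq, h'.size_eq]
  unfold Summary.join prune
  split_ifs with hm
  · exact ⟨hsize, hs, hm, hp, by simp only [List.length_append]; omega, hc⟩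
  · have hn := isNth_nth (l := (mergeCounts s.2 s'.2).map Prod.snd) (r := m) (by simpa using hm)
    set x := nth ((mergeCounts s.2 s'.2).map Prod.snd) m
    have hx := total_reduceCounts_le x (mergeCounts s.2 s'.2)
    have hmul := Nat.mul_le_mul_right x (Nat.succ_le_of_lt hn.2)
    rw [Nat.succ_eq_add_one] at hmul
    refine ⟨hsize, hs.sublist (map_fst_reduceCounts_sublist _ _),
      (length_reduceCounts _ _).trans_le hn.1, pos_of_mem_reduceCounts _ _,
      by simp only [List.length_append]; omega, fun c => ?_⟩
    have h1 := hc c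
    have h2 := Nat.mul_le_mul_left (m + 1) (counter_le_reduceCounts_add x hs c)
    rw [mul_add] at h2
    simp only at *
    omega

theorem mem_of_lt (h : s.Describes m L) {c : B} (hc : L.length < (m + 1) * L.count c) :
    c ∈ s.2.map Prod.fst := by
  by_contra hn
  have := h.count_le c
  rw [counter_eq_zero hn] at this
  omega

/-- Positive counters with total 0 cannot exist. Thus an empty interval has no candidates, although
every color would pass the test against τ · 0. -/
theorem eq_nil (h : s.Describes m []) : s.2 = [] := by
  have h1 := h.total_le
  have h2 := h.pos
  rcases hs : s.2 with _ | ⟨e, l⟩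
  · rfl
  · rw [hs, total_cons] at h1
    have := h2 e (by simp [hs])
    simp at h1; omega

/-- The color occurs in more than a 1/(m+1)-fraction of the one-element list, so it has a counter,
and positivity leaves no room in the total for a second one. A deletion reads the color of its point
in this way. -/
theorem eq_singleton {c : B} (hm : 1 ≤ m) (h : s.Describes m [c]) :
    ∃ k, s.2 = [(c, k)] := by
  have h1 := h.total_le
  have h2 := h.pos
  have h3 := h.mem_of_lt (c := c) (by simp; omega)
  rcases hs : s.2 with _ | ⟨e, _ | ⟨e', l⟩⟩
  · simp [hs] at h3
  · rw [hs] at h3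
    simp at h3
    exact ⟨e.2, by rw [h3]⟩
  · rw [hs, total_cons, total_cons] at h1
    have := h2 e (by simp [hs])
    have := h2 e' (by simp [hs])
    simp at h1; omega

end Summary.Describes

end Summary

/-! ### Search trees -/

/-- A leaf-oriented search tree. An inner node has a summary, a key and two subtrees. -/
inductive Tree (A B : Type*) where
  | nil : Tree A B
  | leaf (e : A × B) : Tree A B
  | node (s : Summary B) (k : A × B) (l r : Tree A B) : Tree A B

namespace Tree

variable {A B : Type*} [LinearOrder A] [LinearOrder B]

section

omit [LinearOrder A] [LinearOrder B]

def toList : Tree A B → List (A × B)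
  | nil => []
  | leaf e => [e]
  | node _ _ l r => l.toList ++ r.toList

def height : Tree A B → ℕ
  | nil => 0
  | leaf _ => 0
  | node _ _ l r => max l.height r.height + 1

def sum : Tree A B → Summary B
  | nil => (0, [])
  | leaf e => (1, [(e.2, 1)])
  | node s _ _ _ => s

def size (t : Tree A B) : ℕ := t.sum.1

end

section

omit [LinearOrder A]

/-- The tree with the given key and subtrees. -/
def mk (m : ℕ) (l : Tree A B) (k : A × B) (r : Tree A B) : Tree A B :=
  node (l.sum.join m r.sum) k l r

/-- Distribute the subtrees of the middle tree to its neighbours. -/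
def split (m : ℕ) (l : Tree A B) (k : A × B) (k' : A × B) (r : Tree A B) : Tree A B → Tree A B
  | node _ k₃ a b => mk m (mk m l k a) k₃ (mk m b k' r)
  | _ => nil

/-- Single or double rotation to the left. -/
def rotL (m : ℕ) (l : Tree A B) (k : A × B) : Tree A B → Tree A B
  | node _ k₂ rl rr =>
    if rr.size + rr.size ≤ rl.size then split m l k k₂ rr rl else mk m (mk m l k rl) k₂ rr
  | _ => nil

/-- Single or double rotation to the right. -/
def rotR (m : ℕ) (k : A × B) (r : Tree A B) : Tree A B → Tree A B
  | node _ k₂ ll lr =>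
    if ll.size + ll.size ≤ lr.size then split m ll k₂ k r lr else mk m ll k₂ (mk m lr k r)
  | _ => nil

/-- The balanced tree for two subtrees that are nearly in balance. -/
def balance (m : ℕ) (l : Tree A B) (k : A × B) (r : Tree A B) : Tree A B :=
  match l, r with
  | nil, r => r
  | l, nil => l
  | l, r =>
    if r.size ≤ l.size + (l.size + l.size) then
      if l.size ≤ r.size + (r.size + r.size) then mk m l k r else rotR m k r l
    else rotL m l k r

end

def insert (m : ℕ) (e : A × B) : Tree A B → Tree A B
  | nil => leaf e
  | leaf k => if toLex e ≤ toLex k then mk m (leaf e) e (leaf k) else mk m (leaf k) k (leaf e)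
  | node _ k l r =>
    if toLex e ≤ toLex k then balance m (l.insert m e) k r else balance m l k (r.insert m e)

/-- A leaf is removed without comparison, because the operation is only used for entries that are
present. Keys of inner nodes are mere separators and may outlive the entry they came from. -/
def delete (m : ℕ) (e : A × B) : Tree A B → Tree A B
  | nil => nil
  | leaf _ => nil
  | node _ k l r =>
    if toLex e ≤ toLex k then balance m (l.delete m e) k r else balance m l k (r.delete m e)

/-- The summary of the entries with first component at least `a`. -/
def from' (m : ℕ) (a : A) : Tree A B → Summary B
  | nil => (0, [])
  | leaf k => if a ≤ k.1 then (leaf k).sum else (0, [])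
  | node _ k l r => if a ≤ k.1 then (l.from' m a).join m r.sum else r.from' m a

/-- The summary of the entries with first component at most `b`. -/
def upto (m : ℕ) (b : A) : Tree A B → Summary B
  | nil => (0, [])
  | leaf k => if k.1 ≤ b then (leaf k).sum else (0, [])
  | node _ k l r => if k.1 ≤ b then l.sum.join m (r.upto m b) else l.upto m b

/-- The summary of the entries with first component in `[a, b]`. -/
def range (m : ℕ) (a b : A) : Tree A B → Summary B
  | nil => (0, [])
  | leaf k => if a ≤ k.1 then if k.1 ≤ b then (leaf k).sum else (0, []) else (0, [])
  | node _ k l r =>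
    if a ≤ k.1 then
      if k.1 ≤ b then (l.from' m a).join m (r.upto m b) else l.range m a b
    else r.range m a b

/-- The number of entries that are at most `e`. -/
def countLE (e : A × B) : Tree A B → ℕ
  | nil => 0
  | leaf k => if toLex k ≤ toLex e then 1 else 0
  | node _ k l r => if toLex k ≤ toLex e then l.size + r.countLE e else l.countLE e

/-- The number of entries that are less than `e`. -/
def countLT (e : A × B) : Tree A B → ℕ
  | nil => 0
  | leaf k => if toLex e ≤ toLex k then 0 else 1
  | node _ k l r => if toLex e ≤ toLex k then l.countLT e else l.size + r.countLT e

/-- The tree is ordered and weight-balanced, and its summaries are correct. -/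
def Valid (m : ℕ) : Tree A B → Prop
  | nil => True
  | leaf _ => True
  | node s k l r =>
    s.Describes m ((l.toList ++ r.toList).map Prod.snd) ∧
    (∀ e ∈ l.toList, toLex e ≤ toLex k) ∧ (∀ e ∈ r.toList, toLex k < toLex e) ∧
    1 ≤ l.toList.length ∧ 1 ≤ r.toList.length ∧
    l.toList.length ≤ 3 * r.toList.length ∧ r.toList.length ≤ 3 * l.toList.length ∧
    l.Valid m ∧ r.Valid m

variable {m : ℕ} {l r t : Tree A B} {k : A × B}

theorem Valid.describes_sum (hm : 1 ≤ m) (h : t.Valid m) :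
    t.sum.Describes m (t.toList.map Prod.snd) := by
  match t, h with
  | nil, _ => exact .empty
  | leaf e, _ => exact .singleton hm _
  | node _ _ _ _, h => exact h.1

theorem Valid.size_eq (hm : 1 ≤ m) (h : t.Valid m) : t.size = t.toList.length := by
  rw [size, (h.describes_sum hm).size_eq, List.length_map]

theorem valid_mk (hm : 1 ≤ m) (hl : l.Valid m) (hr : r.Valid m)
    (hlk : ∀ e ∈ l.toList, toLex e ≤ toLex k) (hkr : ∀ e ∈ r.toList, toLex k < toLex e)
    (h1 : 1 ≤ l.toList.length) (h2 : 1 ≤ r.toList.length)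
    (h3 : l.toList.length ≤ 3 * r.toList.length) (h4 : r.toList.length ≤ 3 * l.toList.length) :
    (mk m l k r).Valid m := by
  refine ⟨?_, hlk, hkr, h1, h2, h3, h4, hl, hr⟩
  rw [List.map_append]
  exact (hl.describes_sum hm).join (hr.describes_sum hm)

omit [LinearOrder A] in
theorem toList_mk : (mk m l k r).toList = l.toList ++ r.toList := rfl

/-- Weights are numbers of leaves. With factor 3 for balance and factor 2 for the choice between
single and double rotation, each new node is in balance, given that the excess is at most 3. All
these conditions are linear in the weights of the pieces. -/
theorem rotL_spec (hm : 1 ≤ m) (hl : l.Valid m) (hr : r.Valid m)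
    (hlk : ∀ e ∈ l.toList, toLex e ≤ toLex k) (hkr : ∀ e ∈ r.toList, toLex k < toLex e)
    (h1 : 1 ≤ l.toList.length) (h2 : 3 * l.toList.length < r.toList.length)
    (h3 : r.toList.length ≤ 3 * l.toList.length + 3) :
    (rotL m l k r).Valid m ∧ (rotL m l k r).toList = l.toList ++ r.toList := by
  match r, hr with
  | nil, _ => simp [toList] at h2
  | leaf _, _ => simp only [toList, List.length_singleton] at h2; omega
  | node _ k₂ rl rr, ⟨_, o1, o2, p1, p2, b1, b2, hrl, hrr⟩ =>
    simp only [toList, List.length_append, List.forall_mem_append] at h2 h3 hkr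
    rw [rotL, hrl.size_eq hm, hrr.size_eq hm]
    split_ifs with hd
    · match rl, hrl with
      | nil, _ => simp [toList] at p1
      | leaf _, _ => simp only [toList, List.length_singleton] at hd; omega
      | node _ k₃ a b, ⟨_, o3, o4, p3, p4, b3, b4, ha, hb⟩ =>
        simp only [toList, List.length_append, List.forall_mem_append] at *
        refine ⟨valid_mk hm (valid_mk hm hl ha hlk hkr.1.1 h1 p3 ?_ ?_)
          (valid_mk hm hb hrr o1.2 o2 p4 p2 ?_ ?_) ?_ ?_ ?_ ?_ ?_ ?_,
          by simp only [split, toList_mk, List.append_assoc]⟩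
        all_goals try simp only [toList_mk, List.length_append, List.forall_mem_append]
        any_goals omega
        -- Separators are compared through an entry lying between them, which exists as the subtrees
        -- of a valid inner node are nonempty.
        · refine ⟨fun e he => (hlk e he).trans ?_, o3⟩
          obtain ⟨e', he'⟩ := List.exists_mem_of_length_pos p3
          exact (hkr.1.1 e' he').le.trans (o3 e' he')
        · refine ⟨o4, fun e he => lt_of_lt_of_le ?_ (o2 e he).le⟩
          obtain ⟨e', he'⟩ := List.exists_mem_of_length_pos p4
          exact (o4 e' he').trans_le (o1.2 e' he')
    · refine ⟨valid_mk hm (valid_mk hm hl hrl hlk hkr.1 h1 p1 ?_ ?_) hrr ?_ o2 ?_ p2 ?_ ?_,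
          by simp only [toList_mk, toList, List.append_assoc]⟩
      all_goals try simp only [toList_mk, List.length_append, List.forall_mem_append]
      any_goals omega
      refine ⟨fun e he => (hlk e he).trans ?_, o1⟩
      obtain ⟨e', he'⟩ := List.exists_mem_of_length_pos p1
      exact (hkr.1 e' he').le.trans (o1 e' he')

theorem rotR_spec (hm : 1 ≤ m) (hl : l.Valid m) (hr : r.Valid m)
    (hlk : ∀ e ∈ l.toList, toLex e ≤ toLex k) (hkr : ∀ e ∈ r.toList, toLex k < toLex e)
    (h1 : 1 ≤ r.toList.length) (h2 : 3 * r.toList.length < l.toList.length)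
    (h3 : l.toList.length ≤ 3 * r.toList.length + 3) :
    (rotR m k r l).Valid m ∧ (rotR m k r l).toList = l.toList ++ r.toList := by
  match l, hl with
  | nil, _ => simp [toList] at h2
  | leaf _, _ => simp only [toList, List.length_singleton] at h2; omega
  | node _ k₂ ll lr, ⟨_, o1, o2, p1, p2, b1, b2, hll, hlr⟩ =>
    simp only [toList, List.length_append, List.forall_mem_append] at h2 h3 hlk
    rw [rotR, hll.size_eq hm, hlr.size_eq hm]
    split_ifs with hd
    · match lr, hlr with
      | nil, _ => simp [toList] at p2
      | leaf _, _ => simp only [toList, List.length_singleton] at hd; omega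
      | node _ k₃ a b, ⟨_, o3, o4, p3, p4, b3, b4, ha, hb⟩ =>
        simp only [toList, List.length_append, List.forall_mem_append] at *
        refine ⟨valid_mk hm (valid_mk hm hll ha o1 o2.1 p1 p3 ?_ ?_)
          (valid_mk hm hb hr hlk.2.2 hkr p4 h1 ?_ ?_) ?_ ?_ ?_ ?_ ?_ ?_,
          by simp only [split, toList_mk, List.append_assoc]⟩
        all_goals try simp only [toList_mk, List.length_append, List.forall_mem_append]
        any_goals omega
        · refine ⟨fun e he => (o1 e he).trans ?_, o3⟩
          obtain ⟨e', he'⟩ := List.exists_mem_of_length_pos p3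
          exact (o2.1 e' he').le.trans (o3 e' he')
        · refine ⟨o4, fun e he => lt_of_lt_of_le ?_ (hkr e he).le⟩
          obtain ⟨e', he'⟩ := List.exists_mem_of_length_pos p4
          exact (o4 e' he').trans_le (hlk.2.2 e' he')
    · refine ⟨valid_mk hm hll (valid_mk hm hlr hr hlk.2 hkr p2 h1 ?_ ?_) o1 ?_ p1 ?_ ?_ ?_,
          by simp only [toList_mk, toList, List.append_assoc]⟩
      all_goals try simp only [toList_mk, List.length_append, List.forall_mem_append]
      any_goals omega
      refine ⟨o2, fun e he => lt_of_le_of_lt ?_ (hkr e he)⟩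
      obtain ⟨e', he'⟩ := List.exists_mem_of_length_pos p2
      exact (o2 e' he').le.trans (hlk.2 e' he')

theorem Valid.eq_nil (h : t.Valid m) (h0 : t.toList.length = 0) : t = nil := by
  match t, h with
  | nil, _ => rfl
  | leaf _, _ => simp [toList] at h0
  | node _ _ _ _, h =>
    have := h.2.2.2.1
    simp only [toList, List.length_append] at h0; omega

omit [LinearOrder A] in
theorem balance_of_ne_nil (hl : l ≠ nil) (hr : r ≠ nil) : balance m l k r =
    if r.size ≤ l.size + (l.size + l.size) then
      if l.size ≤ r.size + (r.size + r.size) then mk m l k r else rotR m k r l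
    else rotL m l k r := by
  cases l <;> cases r <;> first | rfl | contradiction

/-- The slack 3 covers one update in a child of a balanced node. Deleting a leaf on the light side
turns r ≤ 3l into r ≤ 3(l - 1) + 3, and an insertion on the heavy side needs only slack 1. -/
theorem balance_spec (hm : 1 ≤ m) (hl : l.Valid m) (hr : r.Valid m)
    (hlk : ∀ e ∈ l.toList, toLex e ≤ toLex k) (hkr : ∀ e ∈ r.toList, toLex k < toLex e)
    (h1 : l.toList.length ≤ 3 * r.toList.length + 3)
    (h2 : r.toList.length ≤ 3 * l.toList.length + 3) :
    (balance m l k r).Valid m ∧ (balance m l k r).toList = l.toList ++ r.toList := by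
  by_cases hl0 : l = nil
  · subst hl0
    exact ⟨hr, rfl⟩
  by_cases hr0 : r = nil
  · subst hr0
    cases l
    · contradiction
    · exact ⟨hl, rfl⟩
    · exact ⟨hl, by simp [balance, toList]⟩
  have hl1 : 1 ≤ l.toList.length := Nat.one_le_iff_ne_zero.2 fun h => hl0 (hl.eq_nil h)
  have hr1 : 1 ≤ r.toList.length := Nat.one_le_iff_ne_zero.2 fun h => hr0 (hr.eq_nil h)
  rw [balance_of_ne_nil hl0 hr0, hl.size_eq hm, hr.size_eq hm]
  split_ifs
  · exact ⟨valid_mk hm hl hr hlk hkr hl1 hr1 (by omega) (by omega), rfl⟩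
  · exact rotR_spec hm hl hr hlk hkr hr1 (by omega) h1
  · exact rotL_spec hm hl hr hlk hkr hl1 (by omega) h2

theorem insert_spec (hm : 1 ≤ m) (e : A × B) (h : t.Valid m) (he : e ∉ t.toList) :
    (t.insert m e).Valid m ∧ (t.insert m e).toList.Perm (e :: t.toList) := by
  induction t with
  | nil => exact ⟨trivial, .refl _⟩
  | leaf k =>
    rw [insert]
    simp only [toList, List.mem_singleton] at he
    split_ifs with hk
    · refine ⟨valid_mk hm trivial trivial ?_ ?_ ?_ ?_ ?_ ?_, .refl _⟩ <;> simp [toList]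
      exact lt_of_le_of_ne hk fun h => he (toLex.injective h)
    · refine ⟨valid_mk hm trivial trivial ?_ ?_ ?_ ?_ ?_ ?_, .swap _ _ _⟩ <;> simp [toList]
      exact not_le.1 hk
  | node s k l r ihl ihr =>
    obtain ⟨-, o1, o2, p1, p2, b1, b2, hl, hr⟩ := h
    simp only [toList, List.mem_append, not_or] at he
    rw [insert]
    split_ifs with hk
    · obtain ⟨hv, hp⟩ := ihl hl he.1
      have hlen := hp.length_eq
      rw [List.length_cons] at hlen
      obtain ⟨h1, h2⟩ := balance_spec hm hv hr (k := k)
        (fun x hx => by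
          rcases List.mem_cons.1 (hp.mem_iff.1 hx) with rfl | hx
          exacts [hk, o1 x hx]) o2 (by omega) (by omega)
      exact ⟨h1, by rw [h2]; exact hp.append_right _⟩
    · obtain ⟨hv, hp⟩ := ihr hr he.2
      have hlen := hp.length_eq
      rw [List.length_cons] at hlen
      obtain ⟨h1, h2⟩ := balance_spec hm hl hv (k := k) o1
        (fun x hx => by
          rcases List.mem_cons.1 (hp.mem_iff.1 hx) with rfl | hx
          exacts [not_le.1 hk, o2 x hx]) (by omega) (by omega)
      exact ⟨h1, by rw [h2]; exact (hp.append_left _).trans List.perm_middle⟩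

theorem delete_spec (hm : 1 ≤ m) (e : A × B) (h : t.Valid m) (he : e ∈ t.toList) :
    (t.delete m e).Valid m ∧ t.toList.Perm (e :: (t.delete m e).toList) := by
  induction t with
  | nil => simp [toList] at he
  | leaf k =>
    simp only [toList, List.mem_singleton] at he
    subst he
    exact ⟨trivial, .refl _⟩
  | node s k l r ihl ihr =>
    obtain ⟨-, o1, o2, p1, p2, b1, b2, hl, hr⟩ := h
    simp only [toList, List.mem_append] at he
    rw [delete]
    split_ifs with hk
    · have he : e ∈ l.toList := he.resolve_right fun h => (o2 e h).not_ge hk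
      obtain ⟨hv, hp⟩ := ihl hl he
      have hlen := hp.length_eq
      rw [List.length_cons] at hlen
      obtain ⟨h1, h2⟩ := balance_spec hm hv hr (k := k)
        (fun x hx => o1 x (hp.mem_iff.2 (List.mem_cons_of_mem _ hx))) o2 (by omega) (by omega)
      exact ⟨h1, by rw [h2]; exact hp.append_right _⟩
    · have he : e ∈ r.toList := he.resolve_left fun h => hk (o1 e h)
      obtain ⟨hv, hp⟩ := ihr hr he
      have hlen := hp.length_eq
      rw [List.length_cons] at hlen
      obtain ⟨h1, h2⟩ := balance_spec hm hl hv (k := k) o1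
        (fun x hx => o2 x (hp.mem_iff.2 (List.mem_cons_of_mem _ hx))) (by omega) (by omega)
      exact ⟨h1, by rw [h2]; exact (hp.append_left _).trans List.perm_middle⟩

theorem fst_le_of_toLex_le {e k : A × B} (h : toLex e ≤ toLex k) : e.1 ≤ k.1 :=
  (Prod.Lex.toLex_le_toLex'.1 h).1

theorem from_spec (hm : 1 ≤ m) (a : A) (h : t.Valid m) :
    (t.from' m a).Describes m ((t.toList.filter fun e => a ≤ e.1).map Prod.snd) := by
  induction t with
  | nil => exact .empty
  | leaf k =>
    rw [from']
    split_ifs with hk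
    · simpa [toList, sum, hk] using Summary.Describes.singleton hm k.2
    · simpa [toList, hk] using Summary.Describes.empty
  | node s k l r ihl ihr =>
    obtain ⟨-, o1, o2, -, -, -, -, hl, hr⟩ := h
    rw [from', toList, List.filter_append, List.map_append]
    split_ifs with hk
    · rw [List.filter_eq_self (l := r.toList) |>.2 fun e he => by
        simpa using hk.trans (fst_le_of_toLex_le (o2 e he).le)]
      exact (ihl hl).join (hr.describes_sum hm)
    · rw [List.filter_eq_nil_iff (l := l.toList) |>.2 fun e he => by
        simpa using (fst_le_of_toLex_le (o1 e he)).trans_lt (not_le.1 hk)]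
      exact ihr hr

theorem upto_spec (hm : 1 ≤ m) (b : A) (h : t.Valid m) :
    (t.upto m b).Describes m ((t.toList.filter fun e => e.1 ≤ b).map Prod.snd) := by
  induction t with
  | nil => exact .empty
  | leaf k =>
    rw [upto]
    split_ifs with hk
    · simpa [toList, sum, hk] using Summary.Describes.singleton hm k.2
    · simpa [toList, hk] using Summary.Describes.empty
  | node s k l r ihl ihr =>
    obtain ⟨-, o1, o2, -, -, -, -, hl, hr⟩ := h
    rw [upto, toList, List.filter_append, List.map_append]
    split_ifs with hk
    · rw [List.filter_eq_self (l := l.toList) |>.2 fun e he => by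
        simpa using (fst_le_of_toLex_le (o1 e he)).trans hk]
      exact (hl.describes_sum hm).join (ihr hr)
    · rw [List.filter_eq_nil_iff (l := r.toList) |>.2 fun e he => by
        simpa using (not_le.1 hk).trans_le (fst_le_of_toLex_le (o2 e he).le)]
      simpa using ihl hl

theorem range_spec (hm : 1 ≤ m) (a b : A) (h : t.Valid m) :
    (t.range m a b).Describes m
      ((t.toList.filter fun e => a ≤ e.1 ∧ e.1 ≤ b).map Prod.snd) := by
  induction t with
  | nil => exact .empty
  | leaf k =>
    rw [range]
    split_ifs with hk hk'
    · simpa [toList, sum, hk, hk'] using Summary.Describes.singleton hm k.2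
    · simpa [toList, hk, hk'] using Summary.Describes.empty
    · simpa [toList, hk] using Summary.Describes.empty
  | node s k l r ihl ihr =>
    obtain ⟨-, o1, o2, -, -, -, -, hl, hr⟩ := h
    rw [range, toList, List.filter_append, List.map_append]
    split_ifs with hk hk'
    · rw [List.filter_congr (l := l.toList) (q := fun e => a ≤ e.1) fun e he => by
          simpa using fun _ => (fst_le_of_toLex_le (o1 e he)).trans hk',
        List.filter_congr (l := r.toList) (q := fun e => e.1 ≤ b) fun e he => by
          simpa using fun _ => hk.trans (fst_le_of_toLex_le (o2 e he).le)]
      exact (from_spec hm a hl).join (upto_spec hm b hr)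
    · rw [List.filter_eq_nil_iff (l := r.toList) |>.2 fun e he => by
        simpa using fun _ => (not_le.1 hk').trans_le (fst_le_of_toLex_le (o2 e he).le)]
      simpa using ihl hl
    · rw [List.filter_eq_nil_iff (l := l.toList) |>.2 fun e he => by
        simpa using fun h => absurd (h.trans (fst_le_of_toLex_le (o1 e he))) hk]
      simpa using ihr hr

theorem countLE_eq (hm : 1 ≤ m) (e : A × B) (h : t.Valid m) :
    t.countLE e = t.toList.countP fun x => toLex x ≤ toLex e := by
  induction t with
  | nil => rfl
  | leaf k => simp [countLE, toList, List.countP_singleton]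
  | node s k l r ihl ihr =>
    obtain ⟨-, o1, o2, -, -, -, -, hl, hr⟩ := h
    rw [countLE, toList, List.countP_append, ihl hl, ihr hr]
    split_ifs with hk
    · rw [hl.size_eq hm, List.countP_eq_length (l := l.toList) |>.2 fun x hx => by
        simpa using (o1 x hx).trans hk]
    · rw [List.countP_eq_zero (l := r.toList) |>.2 fun x hx => by
        simpa using (not_le.1 hk).trans (o2 x hx), add_zero]

theorem countLT_eq (hm : 1 ≤ m) (e : A × B) (h : t.Valid m) :
    t.countLT e = t.toList.countP fun x => toLex x < toLex e := by
  induction t with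
  | nil => rfl
  | leaf k => simp only [countLT, toList, List.countP_singleton, ← not_le]; split_ifs <;> simp_all
  | node s k l r ihl ihr =>
    obtain ⟨-, o1, o2, -, -, -, -, hl, hr⟩ := h
    rw [countLT, toList, List.countP_append, ihl hl, ihr hr]
    split_ifs with hk
    · rw [List.countP_eq_zero (l := r.toList) |>.2 fun x hx => by
        simpa using hk.trans (o2 x hx).le, add_zero]
    · rw [hl.size_eq hm, List.countP_eq_length (l := l.toList) |>.2 fun x hx => by
        simpa using (o1 x hx).trans_lt (not_le.1 hk)]

/-- Each child has at most 3/4 of the leaves of its parent. Powers of 4 and 3 keep the estimate in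
the natural numbers. -/
theorem Valid.pow_height_le (h : t.Valid m) (h1 : 1 ≤ t.toList.length) :
    4 ^ t.height ≤ 3 ^ t.height * t.toList.length := by
  induction t with
  | nil => simp [toList] at h1
  | leaf _ => simp [height, toList]
  | node s k l r ihl ihr =>
    obtain ⟨-, -, -, p1, p2, b1, b2, hl, hr⟩ := h
    simp only [height, toList, List.length_append, pow_succ]
    rcases le_total l.height r.height with hh | hh
    · rw [max_eq_right hh]
      have := Nat.mul_le_mul_left (3 ^ r.height)
        (show 4 * r.toList.length ≤ 3 * (l.toList.length + r.toList.length) by omega)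
      nlinarith [ihr hr p2]
    · rw [max_eq_left hh]
      have := Nat.mul_le_mul_left (3 ^ l.height)
        (show 4 * l.toList.length ≤ 3 * (l.toList.length + r.toList.length) by omega)
      nlinarith [ihl hl p1]

end Tree

/-! ### Running the operations on search trees -/

section TreeOps

variable {α : Type u} {κ : Type v} [LinearOrder α] [LinearOrder κ]
variable {A B : Type*} [LinearOrder A] [LinearOrder B]

def Val.ofEntry (f : A → Val α κ) (g : B → Val α κ) (e : A × B) : Val α κ := pair (f e.1) (g e.2)

/-- A null first field marks a leaf. An inner node has its summary and key there, so one `casePair`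
tells the two apart. -/
def Val.ofTree (f : A → Val α κ) (g : B → Val α κ) : Tree A B → Val α κ
  | .nil => nil
  | .leaf e => pair nil (ofEntry f g e)
  | .node s k l r => pair (pair (ofSummary g s) (ofEntry f g k)) (pair (ofTree f g l) (ofTree f g r))

variable {w : ℕ} {τ : ℝ} (f : A → Val α κ) (g : B → Val α κ) {m N : ℕ} {t l r : Tree A B}

omit [LinearOrder A] [LinearOrder B] in
theorem calls_sum (hw : 1 < 2 ^ w) (t : Tree A B) :
    Calls w τ Proc.sum (.ofTree f g t) (.ofSummary g t.sum) 1 := by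
  match t with
  | .nil => exact .intro rfl (.caseNil (.var rfl) (.pair (.num (by omega)) .nil)) (by omega)
  | .leaf e =>
    exact .intro rfl (.casePair (.var rfl) (.caseNil (.var rfl) (.casePair (.var rfl)
      (.pair (.num hw) (.pair (.pair (.var rfl) (.num hw)) .nil))))) (by omega)
  | .node s k l r =>
    exact .intro rfl (.casePair (.var rfl) (.casePair (.var rfl) (.var rfl))) (by omega)

omit [LinearOrder A] [LinearOrder B] in
theorem calls_size (hw : 1 < 2 ^ w) (t : Tree A B) :
    Calls w τ Proc.size (.ofTree f g t) (.num t.size) 2 :=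
  .intro rfl (.casePair (.call (.var rfl) (calls_sum f g hw t)) (.var rfl)) (by omega)

theorem calls_lex [Atom f] [Atom g] (hw : 1 < 2 ^ w) (e k : A × B) :
    Calls w τ Proc.lex (.pair (.ofEntry f g e) (.ofEntry f g k))
      (.ofTest (toLex e ≤ toLex k)) 1 := by
  refine .intro rfl (.args2 (.casePair (.var rfl) (.casePair (.var rfl)
    (.ite (.le f (.var rfl) (.var rfl))
      (fun h1 => .ite (.le f (.var rfl) (.var rfl))
        (fun h2 => by
          have : toLex e ≤ toLex k ↔ e.2 ≤ k.2 := by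
            rw [Prod.Lex.toLex_le_toLex']
            exact ⟨fun h => h.2 (le_antisymm h1 h2), fun h => ⟨h1, fun _ => h⟩⟩
          rw [show Val.ofTest (α := α) (κ := κ) (toLex e ≤ toLex k) = .ofTest (e.2 ≤ k.2) by
            simp only [Val.ofTest, this]]
          exact .le g (.var rfl) (.var rfl))
        fun h2 => by
          rw [← Val.ofTest_eq_one.2
            (Prod.Lex.toLex_le_toLex'.2 ⟨h1, fun h => absurd h.ge h2⟩ : toLex e ≤ toLex k)]
          exact .num hw)
      fun h1 => by
        rw [← Val.ofTest_eq_zero.2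
          (fun h => h1 (Tree.fst_le_of_toLex_le h) : ¬ toLex e ≤ toLex k)]
        exact .num (by omega))))) (by omega)

/-- The summary of the tree describes its entries. -/
def Tree.Summed (m : ℕ) (t : Tree A B) : Prop := t.sum.Describes m (t.toList.map Prod.snd)

omit [LinearOrder A] in
-- Running the nested `node` calls of a rotation requires correct summaries only, so the balance of
-- the intermediate trees need not be established for it.
theorem Tree.Summed.mk {k : A × B} (hl : l.Summed m) (hr : r.Summed m) :
    (Tree.mk m l k r).Summed m := by
  unfold Tree.Summed
  rw [Tree.toList_mk, List.map_append]
  exact Summary.Describes.join hl hr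

/-- Sizes and counter totals are bounded by the number of entries described, so the word bound in
terms of m and N covers all sums formed. -/
theorem calls_join_of_describes [Atom g] (hw : 2 * m + 3 * N + 1 < 2 ^ w) {s s' : Summary B}
    {L L' : List B} (h : s.Describes m L) (h' : s'.Describes m L') (hN : L.length + L'.length ≤ N) :
    Calls w τ Proc.join (.pair (.num m) (.pair (.ofSummary g s) (.ofSummary g s')))
      (.ofSummary g (s.join m s')) (joinCost m) := by
  have h1 := h.total_le
  have h2 := h'.total_le
  have h3 := h.size_eq
  have h4 := h'.size_eq
  exact calls_join g m s s' (by omega) (by omega) (by omega) h.length_le h'.length_le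

omit [LinearOrder A] in
theorem calls_node [Atom g] (hw : 2 * m + 3 * N + 1 < 2 ^ w) (hl : l.Summed m) (hr : r.Summed m)
    (hN : l.toList.length + r.toList.length ≤ N) (k : A × B) :
    Calls w τ Proc.node
      (.pair (.num m) (.pair (.ofTree f g l) (.pair (.ofEntry f g k) (.ofTree f g r))))
      (.ofTree f g (Tree.mk m l k r)) (joinCost m + 3) :=
  .intro rfl (.args4 (.pair (.pair (.call (.tuple3 (.var rfl)
      (.call (.var rfl) (calls_sum f g (by omega) l))
      (.call (.var rfl) (calls_sum f g (by omega) r)))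
      (calls_join_of_describes g hw hl hr (by simpa using hN))) (.var rfl))
    (.pair (.var rfl) (.var rfl)))) (by omega)

/-- The number of activations of a rebalancing step. -/
def balanceCost (m : ℕ) : ℕ := 3 * joinCost m + 24

theorem calls_rotL [Atom g] (hm : 1 ≤ m) (hw : 2 * m + 3 * N + 1 < 2 ^ w) (hl : l.Valid m)
    (hr : r.Valid m) (hN : l.toList.length + r.toList.length ≤ N) (k : A × B) :
    Calls w τ Proc.rotL
      (.pair (.num m) (.pair (.ofTree f g l) (.pair (.ofEntry f g k) (.ofTree f g r))))
      (.ofTree f g (Tree.rotL m l k r)) (3 * joinCost m + 16) := by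
  have sl := hl.describes_sum hm
  match r, hr with
  | .nil, _ => exact .intro rfl (.args4 (.caseNil (.var rfl) .nil)) (by omega)
  | .leaf _, _ =>
    exact .intro rfl (.args4 (.casePair (.var rfl) (.caseNil (.var rfl) .nil))) (by omega)
  | .node s k₂ rl rr, ⟨_, _, _, _, _, _, _, hrl, hrr⟩ =>
    have srl := hrl.describes_sum hm
    have srr := hrr.describes_sum hm
    have zl := hrl.size_eq hm
    have zr := hrr.size_eq hm
    simp only [Tree.toList, List.length_append] at hN
    refine .intro rfl (.args4 (.casePair (.var rfl) (.casePair (.var rfl) (.casePair (.var rfl)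
      (.ite (.le .num (.add (.call (.var rfl) (calls_size f g (by omega) rr))
            (.call (.var rfl) (calls_size f g (by omega) rr)) (by omega))
          (.call (.var rfl) (calls_size f g (by omega) rl)))
        (fun h => (?_ : Runs w τ _ _ _ (3 * joinCost m + 9)))
        fun h => (?_ : Runs w τ _ _ _ (2 * joinCost m + 6))))))) (by omega)
    · rw [Tree.rotL, if_pos h]
      match rl, hrl with
      | .nil, _ => exact (Runs.caseNil (.var rfl) .nil).mono (by omega)
      | .leaf _, _ => exact (Runs.casePair (.var rfl) (.caseNil (.var rfl) .nil)).mono (by omega)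
      | .node s k₃ a b, ⟨_, _, _, _, _, _, _, ha, hb⟩ =>
        have sa := ha.describes_sum hm
        have sb := hb.describes_sum hm
        simp only [Tree.toList, List.length_append] at hN
        exact (Runs.casePair (.var rfl) (.casePair (.var rfl) (.casePair (.var rfl)
          (.call (.tuple4 (.var rfl)
            (.call (.tuple4 (.var rfl) (.var rfl) (.var rfl) (.var rfl))
              (calls_node f g hw sl sa (by omega) k)) (.var rfl)
            (.call (.tuple4 (.var rfl) (.var rfl) (.var rfl) (.var rfl))
              (calls_node f g hw sb srr (by omega) k₂)))
            (calls_node f g hw (.mk sl sa) (.mk sb srr)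
              (by simp only [Tree.toList_mk, List.length_append]; omega) k₃))))).mono (by omega)
    · rw [Tree.rotL, if_neg h]
      exact (Runs.call (.tuple4 (.var rfl)
        (.call (.tuple4 (.var rfl) (.var rfl) (.var rfl) (.var rfl))
          (calls_node f g hw sl srl (by omega) k)) (.var rfl) (.var rfl))
        (calls_node f g hw (.mk sl srl) srr
          (by simp only [Tree.toList_mk, List.length_append]; omega) k₂)).mono (by omega)

theorem calls_rotR [Atom g] (hm : 1 ≤ m) (hw : 2 * m + 3 * N + 1 < 2 ^ w) (hl : l.Valid m)
    (hr : r.Valid m) (hN : l.toList.length + r.toList.length ≤ N) (k : A × B) :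
    Calls w τ Proc.rotR
      (.pair (.num m) (.pair (.ofTree f g l) (.pair (.ofEntry f g k) (.ofTree f g r))))
      (.ofTree f g (Tree.rotR m k r l)) (3 * joinCost m + 16) := by
  have sr := hr.describes_sum hm
  match l, hl with
  | .nil, _ => exact .intro rfl (.args4 (.caseNil (.var rfl) .nil)) (by omega)
  | .leaf _, _ =>
    exact .intro rfl (.args4 (.casePair (.var rfl) (.caseNil (.var rfl) .nil))) (by omega)
  | .node s k₂ ll lr, ⟨_, _, _, _, _, _, _, hll, hlr⟩ =>
    have sll := hll.describes_sum hm
    have slr := hlr.describes_sum hm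
    have zl := hll.size_eq hm
    have zr := hlr.size_eq hm
    simp only [Tree.toList, List.length_append] at hN
    refine .intro rfl (.args4 (.casePair (.var rfl) (.casePair (.var rfl) (.casePair (.var rfl)
      (.ite (.le .num (.add (.call (.var rfl) (calls_size f g (by omega) ll))
            (.call (.var rfl) (calls_size f g (by omega) ll)) (by omega))
          (.call (.var rfl) (calls_size f g (by omega) lr)))
        (fun h => (?_ : Runs w τ _ _ _ (3 * joinCost m + 9)))
        fun h => (?_ : Runs w τ _ _ _ (2 * joinCost m + 6))))))) (by omega)
    · rw [Tree.rotR, if_pos h]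
      match lr, hlr with
      | .nil, _ => exact (Runs.caseNil (.var rfl) .nil).mono (by omega)
      | .leaf _, _ => exact (Runs.casePair (.var rfl) (.caseNil (.var rfl) .nil)).mono (by omega)
      | .node s k₃ a b, ⟨_, _, _, _, _, _, _, ha, hb⟩ =>
        have sa := ha.describes_sum hm
        have sb := hb.describes_sum hm
        simp only [Tree.toList, List.length_append] at hN
        exact (Runs.casePair (.var rfl) (.casePair (.var rfl) (.casePair (.var rfl)
          (.call (.tuple4 (.var rfl)
            (.call (.tuple4 (.var rfl) (.var rfl) (.var rfl) (.var rfl))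
              (calls_node f g hw sll sa (by omega) k₂)) (.var rfl)
            (.call (.tuple4 (.var rfl) (.var rfl) (.var rfl) (.var rfl))
              (calls_node f g hw sb sr (by omega) k)))
            (calls_node f g hw (.mk sll sa) (.mk sb sr)
              (by simp only [Tree.toList_mk, List.length_append]; omega) k₃))))).mono (by omega)
    · rw [Tree.rotR, if_neg h]
      exact (Runs.call (.tuple4 (.var rfl) (.var rfl) (.var rfl)
        (.call (.tuple4 (.var rfl) (.var rfl) (.var rfl) (.var rfl))
          (calls_node f g hw slr sr (by omega) k)))
        (calls_node f g hw sll (.mk slr sr)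
          (by simp only [Tree.toList_mk, List.length_append]; omega) k₂)).mono (by omega)

omit [LinearOrder α] [LinearOrder κ] [LinearOrder A] [LinearOrder B] in
theorem exists_ofTree_eq_pair (h : t ≠ .nil) : ∃ x y, Val.ofTree f g t = .pair x y := by
  cases t
  exacts [absurd rfl h, ⟨_, _, rfl⟩, ⟨_, _, rfl⟩]

theorem calls_balance [Atom g] (hm : 1 ≤ m) (hw : 2 * m + 3 * N + 1 < 2 ^ w) (hl : l.Valid m)
    (hr : r.Valid m) (hN : l.toList.length + r.toList.length ≤ N) (k : A × B) :
    Calls w τ Proc.balance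
      (.pair (.num m) (.pair (.ofTree f g l) (.pair (.ofEntry f g k) (.ofTree f g r))))
      (.ofTree f g (Tree.balance m l k r)) (balanceCost m) := by
  unfold balanceCost
  by_cases hl0 : l = .nil
  · subst hl0
    exact .intro rfl (.args4 (.caseNil (.var rfl) (.var rfl))) (by omega)
  obtain ⟨x, y, hxy⟩ := exists_ofTree_eq_pair f g hl0
  by_cases hr0 : r = .nil
  · subst hr0
    rw [show Tree.balance m l k .nil = l by cases l <;> rfl]
    exact .intro rfl (.args4 (.casePair (.var (congrArg some hxy))
      (.caseNil (.var rfl) (.var rfl)))) (by omega)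
  obtain ⟨x', y', hxy'⟩ := exists_ofTree_eq_pair f g hr0
  have zl := hl.size_eq hm
  have zr := hr.size_eq hm
  rw [Tree.balance_of_ne_nil hl0 hr0]
  exact .intro rfl (.args4 (.casePair (.var (congrArg some hxy))
    (.casePair (.var (congrArg some hxy'))
    (.bind (.call (.var rfl) (calls_size f g (by omega) l))
    (.bind (.call (.var rfl) (calls_size f g (by omega) r))
    -- Tripling the size of a subtree is what the term `3 * N` of the word bound is for.
    (.ite (.le .num (.var rfl) (.add (.var rfl) (.add (.var rfl) (.var rfl) (by omega)) (by omega)))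
      (fun h1 => .ite
        (.le .num (.var rfl) (.add (.var rfl) (.add (.var rfl) (.var rfl) (by omega)) (by omega)))
        (fun h2 => by
          rw [if_pos h1, if_pos h2]
          exact .call (.var rfl)
            (calls_node f g hw (hl.describes_sum hm) (hr.describes_sum hm) hN k))
        fun h2 => by
          rw [if_pos h1, if_neg h2]
          exact .call (.var rfl) (calls_rotR f g hm hw hl hr hN k))
      fun h1 => by
        rw [if_neg h1]
        exact .call (.var rfl) (calls_rotL f g hm hw hl hr hN k))))))) (by omega)

/-- The number of activations of an update of a tree of height `h`. -/
def updateCost (m h : ℕ) : ℕ := (h + 1) * (balanceCost m + 3)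

/-- One level of the search path costs a comparison, a rebalancing and the activation itself. The
descent enters only one child, so the costs of the two children are not added. -/
theorem updateCost_max (m h h' : ℕ) :
    updateCost m h + (balanceCost m + 3) ≤ updateCost m (max h h' + 1) ∧
    updateCost m h' + (balanceCost m + 3) ≤ updateCost m (max h h' + 1) := by
  unfold updateCost
  constructor <;> rw [← Nat.succ_mul] <;> gcongr <;> omega

theorem calls_insert [Atom f] [Atom g] (hm : 1 ≤ m) (hw : 2 * m + 3 * N + 1 < 2 ^ w)
    (h : t.Valid m) (hN : t.toList.length + 1 ≤ N) (e : A × B) (he : e ∉ t.toList) :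
    Calls w τ Proc.insert (.pair (.num m) (.pair (.ofEntry f g e) (.ofTree f g t)))
      (.ofTree f g (t.insert m e)) (updateCost m t.height) := by
  induction t with
  | nil =>
    exact .intro rfl (.args3 (.caseNil (.var rfl) (.pair .nil (.var rfl))))
      (by simp [updateCost, Tree.height])
  | leaf k =>
    have hN : 1 + 1 ≤ N := hN
    exact .intro rfl (.args3 (.casePair (.var rfl) (.caseNil (.var rfl)
      (.ite (.call (.pair (.var rfl) (.var rfl)) (calls_lex f g (by omega) e k))
        (fun hk => by
          rw [Tree.insert, if_pos hk]
          exact .call (.tuple4 (.var rfl) (.pair .nil (.var rfl)) (.var rfl) (.var rfl))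
            (calls_node f g (l := .leaf e) (r := .leaf k) hw (.singleton hm _)
              (.singleton hm _) hN e))
        fun hk => by
          rw [Tree.insert, if_neg hk]
          exact .call (.tuple4 (.var rfl) (.var rfl) (.var rfl) (.pair .nil (.var rfl)))
            (calls_node f g (l := .leaf k) (r := .leaf e) hw (.singleton hm _)
              (.singleton hm _) hN k)))))
      (by simp only [updateCost, Tree.height, balanceCost]; omega)
  | node s k l r ihl ihr =>
    obtain ⟨-, -, -, -, -, -, -, hl, hr⟩ := h
    simp only [Tree.toList, List.length_append, List.mem_append, not_or] at hN he
    obtain ⟨c1, c2⟩ := updateCost_max m l.height r.height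
    obtain ⟨vl, pl⟩ := Tree.insert_spec hm e hl he.1
    obtain ⟨vr, pr⟩ := Tree.insert_spec hm e hr he.2
    have pl := pl.length_eq
    have pr := pr.length_eq
    rw [List.length_cons] at pl pr
    exact .intro rfl (.args3 (.casePair (.var rfl) (.casePair (.var rfl) (.casePair (.var rfl)
      (.ite (.call (.pair (.var rfl) (.var rfl)) (calls_lex f g (by omega) e k))
        (fun hk => by
          rw [Tree.insert, if_pos hk]
          exact .call (.tuple4 (.var rfl) (.call (.tuple3 (.var rfl) (.var rfl) (.var rfl))
              (ihl hl (by omega) he.1)) (.var rfl) (.var rfl))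
            (calls_balance f g hm hw vl hr (by omega) k))
        fun hk => by
          rw [Tree.insert, if_neg hk]
          exact .call (.tuple4 (.var rfl) (.var rfl) (.var rfl)
              (.call (.tuple3 (.var rfl) (.var rfl) (.var rfl)) (ihr hr (by omega) he.2)))
            (calls_balance f g hm hw hl vr (by omega) k))))))
      (by simp only [Tree.height]; omega)

theorem calls_delete [Atom f] [Atom g] (hm : 1 ≤ m) (hw : 2 * m + 3 * N + 1 < 2 ^ w)
    (h : t.Valid m) (hN : t.toList.length ≤ N) (e : A × B) (he : e ∈ t.toList) :
    Calls w τ Proc.delete (.pair (.num m) (.pair (.ofEntry f g e) (.ofTree f g t)))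
      (.ofTree f g (t.delete m e)) (updateCost m t.height) := by
  induction t with
  | nil => simp [Tree.toList] at he
  | leaf k =>
    exact .intro rfl (.args3 (.casePair (.var rfl) (.caseNil (.var rfl) .nil)))
      (by simp [updateCost, Tree.height])
  | node s k l r ihl ihr =>
    obtain ⟨-, o1, o2, -, -, -, -, hl, hr⟩ := h
    simp only [Tree.toList, List.length_append, List.mem_append] at hN he
    obtain ⟨c1, c2⟩ := updateCost_max m l.height r.height
    exact .intro rfl (.args3 (.casePair (.var rfl) (.casePair (.var rfl) (.casePair (.var rfl)
      (.ite (.call (.pair (.var rfl) (.var rfl)) (calls_lex f g (by omega) e k))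
        (fun hk => by
          have he : e ∈ l.toList := he.resolve_right fun h => (o2 e h).not_ge hk
          obtain ⟨vl, pl⟩ := Tree.delete_spec hm e hl he
          have pl := pl.length_eq
          rw [List.length_cons] at pl
          rw [Tree.delete, if_pos hk]
          exact .call (.tuple4 (.var rfl) (.call (.tuple3 (.var rfl) (.var rfl) (.var rfl))
              (ihl hl (by omega) he)) (.var rfl) (.var rfl))
            (calls_balance f g hm hw vl hr (by omega) k))
        fun hk => by
          have he : e ∈ r.toList := he.resolve_left fun h => hk (o1 e h)
          obtain ⟨vr, pr⟩ := Tree.delete_spec hm e hr he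
          have pr := pr.length_eq
          rw [List.length_cons] at pr
          rw [Tree.delete, if_neg hk]
          exact .call (.tuple4 (.var rfl) (.var rfl) (.var rfl)
              (.call (.tuple3 (.var rfl) (.var rfl) (.var rfl)) (ihr hr (by omega) he)))
            (calls_balance f g hm hw hl vr (by omega) k))))))
      (by simp only [Tree.height]; omega)

/-- The number of activations of a one-sided summary query in a tree of height `h`. -/
def sideCost (m h : ℕ) : ℕ := (h + 1) * (joinCost m + 2)

theorem sideCost_max (m h h' : ℕ) :
    sideCost m h + (joinCost m + 2) ≤ sideCost m (max h h' + 1) ∧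
    sideCost m h' + (joinCost m + 2) ≤ sideCost m (max h h' + 1) := by
  unfold sideCost
  constructor <;> rw [← Nat.succ_mul] <;> gcongr <;> omega

theorem calls_from [Atom f] [Atom g] (hm : 1 ≤ m) (hw : 2 * m + 3 * N + 1 < 2 ^ w)
    (h : t.Valid m) (hN : t.toList.length ≤ N) (a : A) :
    Calls w τ Proc.from' (.pair (.num m) (.pair (f a) (.ofTree f g t)))
      (.ofSummary g (t.from' m a)) (sideCost m t.height) := by
  induction t with
  | nil =>
    exact .intro rfl (.args3 (.caseNil (.var rfl) (.pair (.num (by omega)) .nil)))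
      (by simp only [sideCost, Tree.height]; omega)
  | leaf k =>
    exact .intro rfl (.args3 (.casePair (.var rfl) (.caseNil (.var rfl) (.casePair (.var rfl)
      (.ite (.le f (.var rfl) (.var rfl))
        (fun hk => by
          rw [Tree.from', if_pos hk]
          exact .call (.var rfl) (calls_sum f g (by omega) (.leaf k)))
        fun hk => by
          rw [Tree.from', if_neg hk]
          exact .pair (.num (by omega)) .nil)))))
      (by simp only [sideCost, Tree.height]; omega)
  | node s k l r ihl ihr =>
    obtain ⟨-, -, -, -, -, -, -, hl, hr⟩ := h
    simp only [Tree.toList, List.length_append] at hN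
    obtain ⟨c1, c2⟩ := sideCost_max m l.height r.height
    have hf := List.length_filter_le (fun e : A × B => decide (a ≤ e.1)) l.toList
    exact .intro rfl (.args3 (.casePair (.var rfl) (.casePair (.var rfl) (.casePair (.var rfl)
      (.ite (.le f (.var rfl) (.casePair (.var rfl) (.var rfl)))
        (fun hk => by
          rw [Tree.from', if_pos hk]
          exact .call (.tuple3 (.var rfl)
              (.call (.tuple3 (.var rfl) (.var rfl) (.var rfl)) (ihl hl (by omega)))
              (.call (.var rfl) (calls_sum f g (by omega) r)))
            (calls_join_of_describes g hw (Tree.from_spec hm a hl) (hr.describes_sum hm)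
              (by simp only [List.length_map]; omega)))
        fun hk => by
          rw [Tree.from', if_neg hk]
          exact .call (.tuple3 (.var rfl) (.var rfl) (.var rfl)) (ihr hr (by omega)))))))
      (by simp only [Tree.height]; omega)

theorem calls_upto [Atom f] [Atom g] (hm : 1 ≤ m) (hw : 2 * m + 3 * N + 1 < 2 ^ w)
    (h : t.Valid m) (hN : t.toList.length ≤ N) (b : A) :
    Calls w τ Proc.upto (.pair (.num m) (.pair (f b) (.ofTree f g t)))
      (.ofSummary g (t.upto m b)) (sideCost m t.height) := by
  induction t with
  | nil =>
    exact .intro rfl (.args3 (.caseNil (.var rfl) (.pair (.num (by omega)) .nil)))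
      (by simp only [sideCost, Tree.height]; omega)
  | leaf k =>
    exact .intro rfl (.args3 (.casePair (.var rfl) (.caseNil (.var rfl) (.casePair (.var rfl)
      (.ite (.le f (.var rfl) (.var rfl))
        (fun hk => by
          rw [Tree.upto, if_pos hk]
          exact .call (.var rfl) (calls_sum f g (by omega) (.leaf k)))
        fun hk => by
          rw [Tree.upto, if_neg hk]
          exact .pair (.num (by omega)) .nil)))))
      (by simp only [sideCost, Tree.height]; omega)
  | node s k l r ihl ihr =>
    obtain ⟨-, -, -, -, -, -, -, hl, hr⟩ := h
    simp only [Tree.toList, List.length_append] at hN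
    obtain ⟨c1, c2⟩ := sideCost_max m l.height r.height
    have hf := List.length_filter_le (fun e : A × B => decide (e.1 ≤ b)) r.toList
    exact .intro rfl (.args3 (.casePair (.var rfl) (.casePair (.var rfl) (.casePair (.var rfl)
      (.ite (.le f (.casePair (.var rfl) (.var rfl)) (.var rfl))
        (fun hk => by
          rw [Tree.upto, if_pos hk]
          exact .call (.tuple3 (.var rfl)
              (.call (.var rfl) (calls_sum f g (by omega) l))
              (.call (.tuple3 (.var rfl) (.var rfl) (.var rfl)) (ihr hr (by omega))))
            (calls_join_of_describes g hw (hl.describes_sum hm) (Tree.upto_spec hm b hr)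
              (by simp only [List.length_map]; omega)))
        fun hk => by
          rw [Tree.upto, if_neg hk]
          exact .call (.tuple3 (.var rfl) (.var rfl) (.var rfl)) (ihl hl (by omega)))))))
      (by simp only [Tree.height]; omega)

/-- There is a single search path down to the node that separates a from b. Below it the query
continues one-sidedly in both subtrees, which explains the factor 2. -/
theorem calls_range [Atom f] [Atom g] (hm : 1 ≤ m) (hw : 2 * m + 3 * N + 1 < 2 ^ w)
    (h : t.Valid m) (hN : t.toList.length ≤ N) (a b : A) :
    Calls w τ Proc.range (.pair (.num m) (.pair (f a) (.pair (f b) (.ofTree f g t))))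
      (.ofSummary g (t.range m a b)) (2 * sideCost m t.height) := by
  induction t with
  | nil =>
    exact .intro rfl (.args4 (.caseNil (.var rfl) (.pair (.num (by omega)) .nil)))
      (by simp only [sideCost, Tree.height]; omega)
  | leaf k =>
    exact .intro rfl (.args4 (.casePair (.var rfl) (.caseNil (.var rfl) (.casePair (.var rfl)
      (.ite (.le f (.var rfl) (.var rfl))
        (fun hk => .ite (.le f (.var rfl) (.var rfl))
          (fun hk' => by
            rw [Tree.range, if_pos hk, if_pos hk']
            exact .call (.var rfl) (calls_sum f g (by omega) (.leaf k)))
          fun hk' => by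
            rw [Tree.range, if_pos hk, if_neg hk']
            exact .pair (.num (by omega)) .nil)
        fun hk => by
          rw [Tree.range, if_neg hk]
          exact .pair (.num (by omega)) .nil)))))
      (by simp only [sideCost, Tree.height]; omega)
  | node s k l r ihl ihr =>
    obtain ⟨-, -, -, -, -, -, -, hl, hr⟩ := h
    simp only [Tree.toList, List.length_append] at hN
    obtain ⟨c1, c2⟩ := sideCost_max m l.height r.height
    have hf := List.length_filter_le (fun e : A × B => decide (a ≤ e.1)) l.toList
    have hf' := List.length_filter_le (fun e : A × B => decide (e.1 ≤ b)) r.toList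
    exact .intro rfl (.args4 (.casePair (.var rfl) (.casePair (.var rfl) (.casePair (.var rfl)
      (.ite (.le f (.var rfl) (.casePair (.var rfl) (.var rfl)))
        (fun hk => .ite (.le f (.casePair (.var rfl) (.var rfl)) (.var rfl))
          (fun hk' => by
            rw [Tree.range, if_pos hk, if_pos hk']
            exact .call (.tuple3 (.var rfl)
                (.call (.tuple3 (.var rfl) (.var rfl) (.var rfl))
                  (calls_from f g hm hw hl (by omega) a))
                (.call (.tuple3 (.var rfl) (.var rfl) (.var rfl))
                  (calls_upto f g hm hw hr (by omega) b)))
              (calls_join_of_describes g hw (Tree.from_spec hm a hl) (Tree.upto_spec hm b hr)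
                (by simp only [List.length_map]; omega)))
          fun hk' => by
            rw [Tree.range, if_pos hk, if_neg hk']
            exact .call (.tuple4 (.var rfl) (.var rfl) (.var rfl) (.var rfl))
              (ihl hl (by omega)))
        fun hk => by
          rw [Tree.range, if_neg hk]
          exact .call (.tuple4 (.var rfl) (.var rfl) (.var rfl) (.var rfl))
            (ihr hr (by omega)))))))
      (by simp only [Tree.height]; omega)

theorem Tree.countLE_le (hm : 1 ≤ m) (h : t.Valid m) (e : A × B) :
    t.countLE e ≤ t.toList.length := by
  rw [Tree.countLE_eq hm e h]; exact List.countP_le_length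

theorem Tree.countLT_le (hm : 1 ≤ m) (h : t.Valid m) (e : A × B) :
    t.countLT e ≤ t.toList.length := by
  rw [Tree.countLT_eq hm e h]; exact List.countP_le_length

theorem calls_countLE [Atom f] [Atom g] (hm : 1 ≤ m) (hw : 2 * m + 3 * N + 1 < 2 ^ w)
    (h : t.Valid m) (hN : t.toList.length ≤ N) (e : A × B) :
    Calls w τ Proc.countLE (.pair (.ofEntry f g e) (.ofTree f g t)) (.num (t.countLE e))
      (4 * (t.height + 1)) := by
  induction t with
  | nil =>
    exact .intro rfl (.args2 (.caseNil (.var rfl) (.num (by omega))))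
      (by simp only [Tree.height]; omega)
  | leaf k =>
    exact .intro rfl (.args2 (.casePair (.var rfl) (.caseNil (.var rfl)
      (.ite (.call (.pair (.var rfl) (.var rfl)) (calls_lex f g (by omega) k e))
        (fun hk => by
          rw [Tree.countLE, if_pos hk]
          exact .num (by omega))
        fun hk => by
          rw [Tree.countLE, if_neg hk]
          exact .num (by omega)))))
      (by simp only [Tree.height]; omega)
  | node s k l r ihl ihr =>
    obtain ⟨-, -, -, -, -, -, -, hl, hr⟩ := h
    simp only [Tree.toList, List.length_append] at hN
    have hs := hl.size_eq hm
    have hc := Tree.countLE_le hm hr e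
    exact .intro rfl (.args2 (.casePair (.var rfl) (.casePair (.var rfl) (.casePair (.var rfl)
      (.ite (.call (.pair (.var rfl) (.var rfl)) (calls_lex f g (by omega) k e))
        (fun hk => by
          rw [Tree.countLE, if_pos hk]
          exact .add (.call (.var rfl) (calls_size f g (by omega) l))
            (.call (.pair (.var rfl) (.var rfl)) (ihr hr (by omega))) (by omega))
        fun hk => by
          rw [Tree.countLE, if_neg hk]
          exact .call (.pair (.var rfl) (.var rfl)) (ihl hl (by omega)))))))
      (by simp only [Tree.height]; omega)

theorem calls_countLT [Atom f] [Atom g] (hm : 1 ≤ m) (hw : 2 * m + 3 * N + 1 < 2 ^ w)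
    (h : t.Valid m) (hN : t.toList.length ≤ N) (e : A × B) :
    Calls w τ Proc.countLT (.pair (.ofEntry f g e) (.ofTree f g t)) (.num (t.countLT e))
      (4 * (t.height + 1)) := by
  induction t with
  | nil =>
    exact .intro rfl (.args2 (.caseNil (.var rfl) (.num (by omega))))
      (by simp only [Tree.height]; omega)
  | leaf k =>
    exact .intro rfl (.args2 (.casePair (.var rfl) (.caseNil (.var rfl)
      (.ite (.call (.pair (.var rfl) (.var rfl)) (calls_lex f g (by omega) e k))
        (fun hk => by
          rw [Tree.countLT, if_pos hk]
          exact .num (by omega))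
        fun hk => by
          rw [Tree.countLT, if_neg hk]
          exact .num (by omega)))))
      (by simp only [Tree.height]; omega)
  | node s k l r ihl ihr =>
    obtain ⟨-, -, -, -, -, -, -, hl, hr⟩ := h
    simp only [Tree.toList, List.length_append] at hN
    have hs := hl.size_eq hm
    have hc := Tree.countLT_le hm hr e
    exact .intro rfl (.args2 (.casePair (.var rfl) (.casePair (.var rfl) (.casePair (.var rfl)
      (.ite (.call (.pair (.var rfl) (.var rfl)) (calls_lex f g (by omega) e k))
        (fun hk => by
          rw [Tree.countLT, if_pos hk]
          exact .call (.pair (.var rfl) (.var rfl)) (ihl hl (by omega)))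
        fun hk => by
          rw [Tree.countLT, if_neg hk]
          exact .add (.call (.var rfl) (calls_size f g (by omega) l))
            (.call (.pair (.var rfl) (.var rfl)) (ihr hr (by omega))) (by omega))))))
      (by simp only [Tree.height]; omega)

omit [LinearOrder B] in
theorem size_ofCounts [LinearOrder B] [Atom g] (l : List (B × ℕ)) :
    (Val.ofCounts g l).size = 4 * l.length + 1 := by
  induction l with
  | nil => rfl
  | cons e l ih =>
    simp only [Val.ofCounts, Val.size, Atom.size_eq, ih, List.length_cons]; omega

/-- A tree with n leaves has 2n - 1 nodes, each of at most 4m + 9 words. Moving the missing node to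
the left side makes the induction additive. -/
theorem size_ofTree_add_le [Atom f] [Atom g] (h : t.Valid m) (h1 : 1 ≤ t.toList.length) :
    (Val.ofTree f g t).size + (4 * m + 9) ≤ (4 * m + 9) * (2 * t.toList.length) := by
  induction t with
  | nil => simp [Tree.toList] at h1
  | leaf k => simp [Val.ofTree, Val.ofEntry, Val.size, Atom.size_eq, Tree.toList]; omega
  | node s k l r ihl ihr =>
    obtain ⟨hs, -, -, p1, p2, -, -, hl, hr⟩ := h
    have := hs.length_le
    have := ihl hl p1
    have := ihr hr p2
    simp only [Val.ofTree, Val.ofEntry, Val.ofSummary, Val.size, Atom.size_eq, Tree.toList,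
      size_ofCounts, List.length_append, mul_add] at *
    omega

end TreeOps

/-! ### Verification of candidates and computation of ⌊1/τ⌋ -/

section Query

variable {α : Type u} {κ : Type v} [LinearOrder α] [LinearOrder κ] {w m N : ℕ} {τ : ℝ}

/-- The candidates with at least `τ * n` points in `[a, b]`. -/
noncomputable def verified (τ : ℝ) (n : ℕ) (a b : α) (t : Tree κ α) (l : List (κ × ℕ)) : List κ :=
  (l.map Prod.fst).filter fun c =>
    τ * (n : ℝ) ≤ ((t.countLE (c, b) - t.countLT (c, a) : ℕ) : ℝ)

theorem calls_verify {t : Tree κ α} (hm : 1 ≤ m) (hw : 2 * m + 3 * N + 1 < 2 ^ w)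
    (h : t.Valid m) (hN : t.toList.length ≤ N) (n : ℕ) (a b : α) (l : List (κ × ℕ)) :
    Calls w τ Proc.verify
      (.pair (.pair (.num n) (.pair (.key a) (.pair (.key b) (.ofTree .col .key t))))
        (.ofCounts .col l))
      (.ofColors (verified τ n a b t l)) (l.length * (8 * (t.height + 1) + 1) + 1) := by
  induction l with
  | nil => exact .intro rfl (.args2 (.caseNil (.var rfl) .nil)) (by omega)
  | cons e l ih =>
    exact .intro rfl (.args2 (.casePair (.var rfl) (.casePair (.var rfl)
      (.bind (.call (.pair (.var rfl) (.var rfl)) ih)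
      (.casePair (.var rfl) (.casePair (.var rfl) (.casePair (.var rfl)
      (.ite (.frac (.sub
            (.call (.pair (.pair (.var rfl) (.var rfl)) (.var rfl))
              (calls_countLE .col .key hm hw h hN (e.1, b)))
            (.call (.pair (.pair (.var rfl) (.var rfl)) (.var rfl))
              (calls_countLT .col .key hm hw h hN (e.1, a)))) (.var rfl))
        (fun hk => by
          rw [show verified τ n a b t (e :: l) = e.1 :: verified τ n a b t l from
            List.filter_cons_of_pos (by simpa using hk)]
          exact .pair (.var rfl) (.var rfl))
        fun hk => by
          rw [show verified τ n a b t (e :: l) = verified τ n a b t l from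
            List.filter_cons_of_neg (by simpa using hk)]
          exact .var rfl))))))))
      (by simp only [List.length_cons, Nat.succ_mul]; omega)

/-- The test τ(j + 1) ≤ 1 holds exactly if j + 1 ≤ ⌊1/τ⌋, so counting upwards stops at this floor.
-/
theorem calls_limit (hm : m = ⌊1 / τ⌋₊) (hτ : 0 < τ) (hw : m + 1 < 2 ^ w) {j : ℕ} (hj : j ≤ m) :
    Calls (α := α) (κ := κ) w τ Proc.limit (.num j) (.num m) (m - j + 1) := by
  have key (i : ℕ) : τ * (i : ℝ) ≤ ((1 : ℕ) : ℝ) ↔ i ≤ m := by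
    rw [hm, Nat.le_floor_iff (by positivity), le_div_iff₀ hτ, mul_comm, Nat.cast_one]
  induction hd : m - j generalizing j with
  | zero =>
    obtain rfl : j = m := by omega
    exact .intro rfl (.ite (.frac (.num (by omega)) (.add (.var rfl) (.num (by omega)) hw))
      (fun h => .absurd (by have := (key _).1 h; omega)) fun _ => .var rfl) (by omega)
  | succ d ih =>
    exact .intro rfl (.ite
      (.frac (.num (by omega)) (.add (.var rfl) (.num (by omega)) (by omega)))
      (fun _ => .call (.add (.var rfl) (.num (by omega)) (by omega))
        (ih (j := j + 1) (by omega) (by omega)))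
      fun h => .absurd (h ((key _).2 (by omega)))) (by omega)

end Query

/-! ### The dynamic data structure -/

section Final

variable {α : Type u} {κ : Type v} [LinearOrder α] [LinearOrder κ]

omit [LinearOrder α] [LinearOrder κ] in
theorem filter_toList_perm {A : Type*} (S : Finset A) (p : A → Prop) [DecidablePred p] :
    (S.toList.filter fun x => p x).Perm (S.filter p).toList := by
  rw [List.perm_ext_iff_of_nodup (S.nodup_toList.filter _) (Finset.nodup_toList _)]
  simp

omit [LinearOrder α] [LinearOrder κ] in
theorem countP_toList {A : Type*} (S : Finset A) (p : A → Prop) [DecidablePred p] :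
    (S.toList.countP fun x => p x) = (S.filter p).card := by
  rw [List.countP_eq_length_filter, (filter_toList_perm S p).length_eq, Finset.length_toList]

omit [LinearOrder α] [LinearOrder κ] in
theorem countP_add_countP {A : Type*} (l : List A) (p q r : A → Prop) [DecidablePred p]
    [DecidablePred q] [DecidablePred r] (h : ∀ x, p x ↔ q x ∨ r x) (h' : ∀ x, q x → ¬ r x) :
    (l.countP fun x => p x) = (l.countP fun x => q x) + l.countP fun x => r x := by
  induction l with
  | nil => rfl
  | cons x l ih =>
    have h1 := h x
    have h2 := h' x
    simp only [List.countP_cons, ih, decide_eq_true_eq]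
    split_ifs <;> first | omega | tauto

/-- The two trees hold the point set `S`, ordered by coordinate and by color. -/
structure Represents (m : ℕ) (S : Finset (α × κ)) (T : Tree α κ) (T' : Tree κ α) : Prop where
  valid : T.Valid m
  valid' : T'.Valid m
  perm : T.toList.Perm S.toList
  perm' : T'.toList.Perm (S.toList.map Prod.swap)
  injOn : ∀ p ∈ S, ∀ q ∈ S, p.1 = q.1 → p = q

def Val.ofTrees (T : Tree α κ) (T' : Tree κ α) : Val α κ :=
  pair (ofTree .key .col T) (ofTree .col .key T')

/-- A bound for the height of a tree with `n` leaves. -/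
noncomputable def heightBound (n : ℕ) : ℕ := ⌊4 * Real.log ((n : ℝ) + 2)⌋₊

theorem Tree.Valid.height_le {A B : Type*} [LinearOrder A] [LinearOrder B] {m : ℕ} {t : Tree A B}
    (h : t.Valid m) : t.height ≤ heightBound t.toList.length := by
  rcases Nat.eq_zero_or_pos t.toList.length with h0 | h0
  · rw [h.eq_nil h0]; exact Nat.zero_le _
  have hp : (4 : ℝ) ^ t.height ≤ 3 ^ t.height * t.toList.length := by
    exact_mod_cast h.pow_height_le h0
  have hn : (0 : ℝ) < t.toList.length := by exact_mod_cast h0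
  have hl := Real.log_le_log (by positivity) hp
  rw [Real.log_mul (by positivity) (by positivity), Real.log_pow, Real.log_pow] at hl
  -- This gives log(4/3) ≥ 1 - 3/4 = 1/4, the source of the factor 4 in `heightBound`.
  have h43 := Real.one_sub_inv_le_log_of_pos (x := (4 / 3 : ℝ)) (by norm_num)
  rw [Real.log_div (by norm_num) (by norm_num)] at h43
  have hmono : Real.log t.toList.length ≤ Real.log ((t.toList.length : ℝ) + 2) :=
    Real.log_le_log hn (by linarith)
  have hh : (0 : ℝ) ≤ t.height := by positivity
  refine Nat.le_floor ?_
  norm_num at h43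
  nlinarith

/-- A bound for the number of activations of each operation. -/
def operationCost (m h : ℕ) : ℕ :=
  (m + 2) + (2 * sideCost m h + (2 * updateCost m h + m * (8 * (h + 1) + 1)))

theorem updateCost_mono (m : ℕ) {h h' : ℕ} (hh : h ≤ h') : updateCost m h ≤ updateCost m h' := by
  unfold updateCost; gcongr

theorem sideCost_mono (m : ℕ) {h h' : ℕ} (hh : h ≤ h') : sideCost m h ≤ sideCost m h' := by
  unfold sideCost; gcongr

namespace Represents

variable {m N w : ℕ} {τ : ℝ} {S : Finset (α × κ)} {T : Tree α κ} {T' : Tree κ α}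

theorem length_eq (h : Represents m S T T') : T.toList.length = S.card := by
  rw [h.perm.length_eq, Finset.length_toList]

theorem length_eq' (h : Represents m S T T') : T'.toList.length = S.card := by
  rw [h.perm'.length_eq, List.length_map, Finset.length_toList]

theorem height_le (h : Represents m S T T') : T.height ≤ heightBound S.card :=
  h.length_eq ▸ h.valid.height_le

theorem height_le' (h : Represents m S T T') : T'.height ≤ heightBound S.card :=
  h.length_eq' ▸ h.valid'.height_le

theorem empty : Represents m (∅ : Finset (α × κ)) .nil .nil :=
  ⟨trivial, trivial, by simp [Tree.toList], by simp [Tree.toList], by simp⟩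

theorem size_le (h : Represents m S T T') :
    (Val.ofTrees T T').size ≤ 4 * (4 * m + 9) * S.card + 3 := by
  unfold Val.ofTrees Val.size
  rcases Nat.eq_zero_or_pos S.card with h0 | h0
  · rw [h.valid.eq_nil (h.length_eq.trans h0), h.valid'.eq_nil (h.length_eq'.trans h0)]
    simp [Val.ofTree, Val.size]
  · have h1 := size_ofTree_add_le (α := α) (κ := κ) .key .col h.valid (h.length_eq ▸ h0)
    have h2 := size_ofTree_add_le (α := α) (κ := κ) .col .key h.valid' (h.length_eq' ▸ h0)
    rw [h.length_eq] at h1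
    rw [h.length_eq'] at h2
    nlinarith

theorem runs_insert (h : Represents m S T T') (hm : 1 ≤ m) (hmτ : m = ⌊1 / τ⌋₊) (hτ : 0 < τ)
    (hw : 2 * m + 3 * N + 1 < 2 ^ w) (hN : S.card < N) {x : α} (c : κ)
    (hx : ∀ p ∈ S, p.1 ≠ x) :
    ∃ U U', Runs w τ [Val.ofTrees T T', .key x, .col c] summaryTrees.insert (Val.ofTrees U U')
        (operationCost m (heightBound S.card)) ∧
      Represents m (Insert.insert (x, c) S) U U' := by
  have hS : (x, c) ∉ S := fun hS => hx _ hS rfl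
  have hT : (x, c) ∉ T.toList := by rwa [h.perm.mem_iff, Finset.mem_toList]
  have hT' : (c, x) ∉ T'.toList := by
    rw [h.perm'.mem_iff]
    simpa using hS
  have hl := h.length_eq
  have hl' := h.length_eq'
  obtain ⟨v, p⟩ := Tree.insert_spec hm (x, c) h.valid hT
  obtain ⟨v', p'⟩ := Tree.insert_spec hm (c, x) h.valid' hT'
  refine ⟨T.insert m (x, c), T'.insert m (c, x), ?_, v, v', ?_, ?_, ?_⟩
  · have c1 := updateCost_mono m h.height_le
    have c2 := updateCost_mono m h.height_le'
    refine Runs.mono (.casePair (.var rfl)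
      (.bind (.call (.num (by omega)) (calls_limit hmτ hτ (by omega) (Nat.zero_le m)))
      (.pair (.call (.tuple3 (.var rfl) (.pair (.var rfl) (.var rfl)) (.var rfl))
          (calls_insert .key .col hm hw h.valid (by omega) (x, c) hT))
        (.call (.tuple3 (.var rfl) (.pair (.var rfl) (.var rfl)) (.var rfl))
          (calls_insert .col .key hm hw h.valid' (by omega) (c, x) hT'))))) ?_
    unfold operationCost
    omega
  · exact p.trans ((h.perm.cons _).trans (Finset.toList_insert hS).symm)
  · exact p'.trans ((h.perm'.cons _).trans ((Finset.toList_insert hS).map Prod.swap).symm)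
  · intro p hp q hq hpq
    rw [Finset.mem_insert] at hp hq
    rcases hp with rfl | hp <;> rcases hq with rfl | hq
    · rfl
    · exact (hx q hq hpq.symm).elim
    · exact (hx p hp hpq).elim
    · exact h.injOn p hp q hq hpq

theorem runs_delete (h : Represents m S T T') (hm : 1 ≤ m) (hmτ : m = ⌊1 / τ⌋₊) (hτ : 0 < τ)
    (hw : 2 * m + 3 * N + 1 < 2 ^ w) (hN : S.card ≤ N) {x : α} {c : κ} (hx : (x, c) ∈ S) :
    ∃ U U', Runs w τ [Val.ofTrees T T', .key x] summaryTrees.delete (Val.ofTrees U U')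
        (operationCost m (heightBound S.card)) ∧
      Represents m (S.erase (x, c)) U U' := by
  have hT : (x, c) ∈ T.toList := by rwa [h.perm.mem_iff, Finset.mem_toList]
  have hT' : (c, x) ∈ T'.toList := by
    rw [h.perm'.mem_iff]
    simpa using hx
  have hl := h.length_eq
  have hl' := h.length_eq'
  obtain ⟨v, p⟩ := Tree.delete_spec hm (x, c) h.valid hT
  obtain ⟨v', p'⟩ := Tree.delete_spec hm (c, x) h.valid' hT'
  have hS : S.toList.Perm ((x, c) :: (S.erase (x, c)).toList) := by
    conv_lhs => rw [← Finset.insert_erase hx]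
    exact Finset.toList_insert (Finset.notMem_erase _ _)
  refine ⟨T.delete m (x, c), T'.delete m (c, x), ?_, v, v', ?_, ?_, ?_⟩
  · have c1 := updateCost_mono m h.height_le
    have c2 := updateCost_mono m h.height_le'
    have c3 := sideCost_mono m h.height_le
    -- Coordinates are distinct, so the point to be deleted is the only one in [x, x].
    have hperm : (T.toList.filter fun e => x ≤ e.1 ∧ e.1 ≤ x).Perm [(x, c)] := by
      refine (h.perm.filter _).trans ?_
      rw [List.perm_ext_iff_of_nodup (S.nodup_toList.filter _) (by simp)]
      intro e
      simp only [List.mem_filter, Finset.mem_toList, decide_eq_true_eq, List.mem_singleton]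
      refine ⟨fun he => h.injOn e he.1 _ hx (le_antisymm he.2.2 he.2.1), ?_⟩
      rintro rfl
      exact ⟨hx, le_rfl, le_rfl⟩
    obtain ⟨k, hk⟩ := ((Tree.range_spec hm x x h.valid).perm (hperm.map Prod.snd)).eq_singleton hm
    refine Runs.mono (.casePair (.var rfl)
      (.bind (.call (.num (by omega)) (calls_limit hmτ hτ (by omega) (Nat.zero_le m)))
      (.casePair (.call (.tuple4 (.var rfl) (.var rfl) (.var rfl) (.var rfl))
        (calls_range .key .col hm hw h.valid (by omega) x x))
      (.casePair (x := .pair (.col c) (.num k)) (y := .nil)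
        (.var (congrArg (fun l => some (Val.ofCounts .col l)) hk))
      (.casePair (.var rfl)
      (.pair (.call (.tuple3 (.var rfl) (.pair (.var rfl) (.var rfl)) (.var rfl))
          (calls_delete .key .col hm hw h.valid (by omega) (x, c) hT))
        (.call (.tuple3 (.var rfl) (.pair (.var rfl) (.var rfl)) (.var rfl))
          (calls_delete .col .key hm hw h.valid' (by omega) (c, x) hT')))))))) ?_
    unfold operationCost
    omega
  · exact (List.perm_cons _).1 (p.symm.trans (h.perm.trans hS))
  · exact (List.perm_cons _).1 (p'.symm.trans (h.perm'.trans (hS.map Prod.swap)))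
  · exact fun p hp q hq => h.injOn p (Finset.mem_of_mem_erase hp) q (Finset.mem_of_mem_erase hq)

/-- In the order by color and then coordinate, the points of color c in [a, b] are consecutive. The
entries up to (c, b) split into those before (c, a) and these points. For a > b the decomposition
fails, hence the assumption. -/
theorem countLE_sub_countLT (h : Represents m S T T') (hm : 1 ≤ m) {a b : α} (hab : a ≤ b)
    (c : κ) : T'.countLE (c, b) - T'.countLT (c, a) =
      ((inRange S a b).filter fun p => p.2 = c).card := by
  have key (y : κ × α) : toLex y ≤ toLex (c, b) ↔
      toLex y < toLex (c, a) ∨ (y.1 = c ∧ a ≤ y.2 ∧ y.2 ≤ b) := by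
    rw [Prod.Lex.toLex_le_toLex, Prod.Lex.toLex_lt_toLex]
    constructor
    · rintro (h | ⟨h, h'⟩)
      · exact .inl (.inl h)
      · rcases lt_or_ge y.2 a with hy | hy
        exacts [.inl (.inr ⟨h, hy⟩), .inr ⟨h, hy, h'⟩]
    · rintro ((h | ⟨h, h'⟩) | ⟨h, h', h''⟩)
      exacts [.inl h, .inr ⟨h, h'.le.trans hab⟩, .inr ⟨h, h''⟩]
  rw [Tree.countLE_eq hm _ h.valid', Tree.countLT_eq hm _ h.valid',
    countP_add_countP _ _ _ _ key, Nat.add_sub_cancel_left, h.perm'.countP_eq, List.countP_map,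
    inRange, Finset.filter_filter, ← countP_toList]
  · refine List.countP_congr fun p _ => ?_
    simp only [Function.comp, Prod.fst_swap, Prod.snd_swap, decide_eq_true_eq]
    tauto
  · rintro y hy ⟨rfl, hy', -⟩
    rw [Prod.Lex.toLex_lt_toLex] at hy
    rcases hy with hy | hy
    exacts [lt_irrefl _ hy, hy.2.not_ge hy']

theorem runs_query (h : Represents m S T T') (hm : 1 ≤ m) (hmτ : m = ⌊1 / τ⌋₊) (hτ : 0 < τ)
    (hw : 2 * m + 3 * N + 1 < 2 ^ w) (hN : S.card ≤ N) (a b : α) :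
    ∃ out : List κ, Runs w τ [Val.ofTrees T T', .key a, .key b] summaryTrees.query (.ofColors out)
        (operationCost m (heightBound S.card)) ∧
      out.Nodup ∧ ∀ c, c ∈ out ↔ Dominates τ S a b c := by
  have hl := h.length_eq
  have hl' := h.length_eq'
  have hd := Tree.range_spec hm a b h.valid
  have hperm : (T.toList.filter fun e => a ≤ e.1 ∧ e.1 ≤ b).Perm (inRange S a b).toList :=
    (h.perm.filter _).trans (filter_toList_perm S _)
  have hd := hd.perm (hperm.map Prod.snd)
  set s := T.range m a b with hs
  have hsize : s.1 = (inRange S a b).card := by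
    rw [hd.size_eq, List.length_map, Finset.length_toList]
  refine ⟨verified τ s.1 a b T' s.2, ?_, (hd.sorted.imp ne_of_lt).filter _, fun c => ?_⟩
  · have c3 := sideCost_mono m h.height_le
    have c4 := Nat.mul_le_mul hd.length_le
      (show 8 * (T'.height + 1) + 1 ≤ 8 * (heightBound S.card + 1) + 1 by
        have := h.height_le'; omega)
    refine Runs.mono (.casePair (.var rfl)
      (.bind (.call (.num (by omega)) (calls_limit hmτ hτ (by omega) (Nat.zero_le m)))
      (.casePair (.call (.tuple4 (.var rfl) (.var rfl) (.var rfl) (.var rfl))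
        (calls_range .key .col hm hw h.valid (by omega) a b))
      (.call (.pair (.tuple4 (.var rfl) (.var rfl) (.var rfl) (.var rfl)) (.var rfl))
        (calls_verify hm hw h.valid' (by omega) s.1 a b s.2))))) ?_
    unfold operationCost
    omega
  · rw [verified, List.mem_filter, decide_eq_true_eq, hsize]
    rcases (inRange S a b).eq_empty_or_nonempty with h0 | h0
    -- An empty interval has no dominating color, and its summary offers no candidate.
    · rw [h0, Finset.toList_empty, List.map_nil] at hd
      simp [hd.eq_nil, Dominates, h0]
    · obtain ⟨p, hp⟩ := h0
      have hp' := (Finset.mem_filter.1 hp).2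
      rw [h.countLE_sub_countLT hm (hp'.1.trans hp'.2), Dominates, 
        and_iff_right (show (inRange S a b).Nonempty from ⟨p, hp⟩),
        and_iff_right_iff_imp]
      intro hc
      -- The exact test decides about every candidate, so it remains to see that a dominating color
      -- is a candidate. From count ≥ τL, L > 0 and τ(m+1) > 1 it follows that L < (m+1) · count.
      apply hd.mem_of_lt
      rw [List.length_map, Finset.length_toList, List.count_eq_countP, List.countP_map]
      have hcount : (inRange S a b).toList.countP ((fun x => x == c) ∘ Prod.snd) =
          ((inRange S a b).filter fun p => p.2 = c).card := by
        rw [← countP_toList]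
        exact List.countP_congr fun p _ => by simp
      rw [hcount]
      have hpos : (0 : ℝ) < (inRange S a b).card := by
        exact_mod_cast Finset.card_pos.2 ⟨p, hp⟩
      have hfl : 1 / τ < (m : ℝ) + 1 := hmτ ▸ Nat.lt_floor_add_one (1 / τ)
      rw [div_lt_iff₀ hτ] at hfl
      have : ((inRange S a b).card : ℝ) <
          ((m + 1 : ℕ) : ℝ) * (((inRange S a b).filter fun p => p.2 = c).card : ℝ) := by
        push_cast
        nlinarith
      exact_mod_cast this

end Represents

theorem nodes_summaryTrees_le :
    summaryTrees.empty.nodes ≤ activationCost ∧ summaryTrees.insert.nodes ≤ activationCost ∧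
      summaryTrees.delete.nodes ≤ activationCost ∧ summaryTrees.query.nodes ≤ activationCost := by
  decide

theorem cost_le {τ : ℝ} {m n t k : ℕ} (hτ : 0 < τ) (hτ1 : τ ≤ 1) (hmτ : m = ⌊1 / τ⌋₊)
    (hk : k ≤ activationCost)
    (ht : t ≤ k + activationCost * operationCost m (heightBound n)) :
    (t : ℝ) ≤ 5000000 * (Real.log ((n : ℝ) + 2) / τ) := by
  -- When `operationCost` is expanded, no coefficient exceeds 2666. The factor 150 and the steps of
  -- the operation's own text fit into 400800 = 150 · 2672.
  have h1 : t ≤ 400800 * ((m + 1) * (heightBound n + 1)) := by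
    refine ht.trans ?_
    simp only [operationCost, sideCost, updateCost, balanceCost, joinCost, activationCost] at *
    nlinarith [Nat.zero_le (m * heightBound n)]
  have hlog : (1 : ℝ) / 2 ≤ Real.log ((n : ℝ) + 2) := by
    have := Real.log_two_gt_d9
    have := Real.log_le_log (x := 2) (y := (n : ℝ) + 2) (by norm_num)
      (by linarith [Nat.cast_nonneg (α := ℝ) n])
    linarith
  have h2 : (heightBound n : ℝ) ≤ 4 * Real.log ((n : ℝ) + 2) := Nat.floor_le (by linarith)
  have h3 : (m : ℝ) ≤ 1 / τ := hmτ ▸ Nat.floor_le (by positivity)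
  have h4 : (1 : ℝ) ≤ 1 / τ := by rw [le_div_iff₀ hτ]; linarith
  calc (t : ℝ) ≤ 400800 * (((m : ℝ) + 1) * ((heightBound n : ℝ) + 1)) := by exact_mod_cast h1
    -- The two summands 1 are absorbed by 1 ≤ 1/τ and 1 ≤ 2 log(n + 2).
    _ ≤ 400800 * ((2 * (1 / τ)) * (6 * Real.log ((n : ℝ) + 2))) := by
      gcongr <;> linarith
    _ ≤ 5000000 * (Real.log ((n : ℝ) + 2) / τ) := by
      have : 0 ≤ Real.log ((n : ℝ) + 2) / τ := by positivity
      linarith [show 400800 * ((2 * (1 / τ)) * (6 * Real.log ((n : ℝ) + 2))) =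
        4809600 * (Real.log ((n : ℝ) + 2) / τ) by ring]

theorem summaryTrees_supports : DynStructure.Supports.{u, v} summaryTrees 5000000
    (fun τ n => 5000000 * ((n : ℝ) / τ + 1))
    (fun τ n => 5000000 * (Real.log ((n : ℝ) + 2) / τ)) := by
  intro α κ _ _ τ w N hτ hτ1 hw
  obtain ⟨m, hmτ⟩ : ∃ m, m = ⌊1 / τ⌋₊ := ⟨_, rfl⟩
  have h1 : (1 : ℝ) ≤ 1 / τ := by rw [le_div_iff₀ hτ]; linarith
  have hm : 1 ≤ m := hmτ ▸ Nat.le_floor (by simpa using h1)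
  have hmle : (m : ℝ) ≤ 1 / τ := hmτ ▸ Nat.floor_le (by positivity)
  have hN0 : (0 : ℝ) ≤ N := Nat.cast_nonneg N
  -- The real word-size hypothesis becomes one inequality between integers, which all machine lemmas
  -- share.
  have hw : 2 * m + 3 * N + 1 < 2 ^ w := by
    have : 2 * (m : ℝ) + 3 * N + 1 < 2 ^ w := by linarith
    exact_mod_cast this
  obtain ⟨n1, n2, n3, n4⟩ := nodes_summaryTrees_le
  refine ⟨⟨.pair .nil .nil, _, .pair .nil .nil, by norm_num⟩, fun S s L hR => ?_⟩
  -- The histories in `Reach` use arbitrary evaluations, which determinism identifies with the runs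
  -- constructed above. Every single deletion obeys its bound, so the amortized bound is a termwise
  -- sum.
  have key : S.card ≤ N ∧ (∃ T T', s = Val.ofTrees T T' ∧ Represents m S T T') ∧
      ∀ d ∈ L, (d.2 : ℝ) ≤ 5000000 * (Real.log ((d.1 : ℝ) + 2) / τ) := by
    induction hR with
    | empty h =>
      refine ⟨by simp, ⟨.nil, .nil, ?_, .empty⟩, by simp⟩
      exact (h.det (.pair .nil .nil)).1
    | insert x c _ hx hN he ih =>
      obtain ⟨-, ⟨T, T', rfl, h⟩, hL⟩ := ih
      obtain ⟨U, U', ⟨t, ht, -⟩, hU⟩ := h.runs_insert hm hmτ hτ hw hN c hx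
      exact ⟨(Finset.card_insert_le _ _).trans hN, ⟨U, U', (he.det ht).1, hU⟩, hL⟩
    | delete x c _ hx he ih =>
      obtain ⟨hN, ⟨T, T', rfl, h⟩, hL⟩ := ih
      obtain ⟨U, U', ⟨t, ht, hle⟩, hU⟩ := h.runs_delete hm hmτ hτ hw hN hx
      obtain ⟨rfl, rfl⟩ := he.det ht
      refine ⟨(Finset.card_erase_le).trans hN, ⟨U, U', rfl, hU⟩, ?_⟩
      rw [List.forall_mem_cons]
      exact ⟨cost_le hτ hτ1 hmτ n3 hle, hL⟩
  obtain ⟨hN, ⟨T, T', rfl, h⟩, hL⟩ := key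
  refine ⟨?_, fun a b => ?_, fun x c hx hlt => ?_, fun x c hx => ?_, ?_⟩
  · have hs : ((Val.ofTrees T T').size : ℝ) ≤ 4 * (4 * m + 9) * S.card + 3 := by
      exact_mod_cast h.size_le
    have hc : (0 : ℝ) ≤ S.card := Nat.cast_nonneg _
    have := mul_le_mul_of_nonneg_right (show 4 * (4 * (m : ℝ) + 9) ≤ 52 * (1 / τ) by linarith) hc
    have : (0 : ℝ) ≤ S.card / τ := by positivity
    have e : 52 * (1 / τ) * S.card = 52 * (S.card / τ) := by ring
    linarith
  · obtain ⟨out, ⟨t, ht, hle⟩, h1, h2⟩ := h.runs_query hm hmτ hτ hw hN a b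
    exact ⟨out, t, ht, h1, h2, cost_le hτ hτ1 hmτ n4 hle⟩
  · obtain ⟨U, U', ⟨t, ht, hle⟩, -⟩ := h.runs_insert hm hmτ hτ hw hlt c hx
    exact ⟨_, t, ht, cost_le hτ hτ1 hmτ n2 hle⟩
  · obtain ⟨U, U', ⟨t, ht, -⟩, -⟩ := h.runs_delete hm hmτ hτ hw hN hx
    exact ⟨_, t, ht⟩
  · exact List.sum_le_sum hL

end Final

theorem DynStructure.Supports.mono {D : DynStructure} {K K' : ℝ}
    {space space' time time' : ℝ → ℕ → ℝ}
    (h : DynStructure.Supports.{u, v} D K space time) (hK : K ≤ K')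
    (hspace : ∀ τ n, 0 < τ → space τ n ≤ space' τ n)
    (htime : ∀ τ n, 0 < τ → time τ n ≤ time' τ n) :
    DynStructure.Supports.{u, v} D K' space' time' := by
  intro α κ _ _ τ w N hτ hτ1 hw
  have hw : K * ((N : ℝ) + 1 / τ) ≤ 2 ^ w :=
    (mul_le_mul_of_nonneg_right hK (by positivity)).trans hw
  obtain ⟨⟨s, t, hs, ht⟩, h⟩ := h α κ τ w N hτ hτ1 hw
  refine ⟨⟨s, t, hs, ht.trans hK⟩, fun S s L hR => ?_⟩
  obtain ⟨h1, h2, h3, h4, h5⟩ := h S s L hR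
  refine ⟨h1.trans (hspace _ _ hτ), fun a b => ?_, fun x c hx hN => ?_, h4,
    h5.trans (List.sum_le_sum fun d _ => htime _ _ hτ)⟩
  · obtain ⟨out, t, g1, g2, g3, g4⟩ := h2 a b
    exact ⟨out, t, g1, g2, g3, g4.trans (htime _ _ hτ)⟩
  · obtain ⟨s', t, g1, g2⟩ := h3 x c hx hN
    exact ⟨s', t, g1, g2.trans (htime _ _ hτ)⟩

end Domination

/-- The number `n + 2` inside the logarithm makes the bounds meaningful for `n ≤ 1`. -/
theorem theorem3 :
    (∃ (D : Domination.DynStructure) (C : ℝ), Domination.DynStructure.Supports.{u, v} D C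
      (fun τ n => C * ((n : ℝ) / τ + 1))
      (fun τ n => C * (Real.log ((n : ℝ) + 2) ^ 2 / τ))) ∧
    (∃ (D : Domination.DynStructure) (C : ℝ), Domination.DynStructure.Supports.{u, v} D C
      (fun τ n => C * ((n : ℝ) * Real.log ((n : ℝ) + 2) / τ + 1))
      (fun τ n => C * (Real.log ((n : ℝ) + 2) / τ))) := by
  have hlog (n : ℕ) : (1 : ℝ) / 2 ≤ Real.log ((n : ℝ) + 2) := by
    have := Real.log_two_gt_d9
    have := Real.log_le_log (x := 2) (y := (n : ℝ) + 2) (by norm_num)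
      (by linarith [Nat.cast_nonneg (α := ℝ) n])
    linarith
  -- Both claims use the same structure. Doubling the constant pays for 1 ≤ 2 log(n + 2), by which a
  -- superfluous logarithm is inserted into the time in (1) and into the space in (2).
  refine ⟨⟨Domination.summaryTrees, 10000000,
    Domination.summaryTrees_supports.mono (by norm_num) (fun τ n hτ => ?_) fun τ n hτ => ?_⟩,
    ⟨Domination.summaryTrees, 10000000,
    Domination.summaryTrees_supports.mono (by norm_num) (fun τ n hτ => ?_) fun τ n hτ => ?_⟩⟩
  · gcongr; norm_num
  · have h : Real.log ((n : ℝ) + 2) ≤ 2 * Real.log ((n : ℝ) + 2) ^ 2 := by nlinarith [hlog n]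
    have := div_le_div_of_nonneg_right h hτ.le
    rw [mul_div_assoc] at this
    linarith
  · have h : (n : ℝ) ≤ 2 * (n * Real.log ((n : ℝ) + 2)) := by
      nlinarith [hlog n, Nat.cast_nonneg (α := ℝ) n]
    have := div_le_div_of_nonneg_right h hτ.le
    rw [mul_div_assoc] at this
    linarith
  · have := hlog n
    gcongr; norm_num
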